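/- Let $K$ be a field with $\operatorname{char} K\neq 2,3$, let $f(x)=x^6+ax^3+b\in K[x]$ be irreducible over $K$, and let $F$ be a splitting field of $f$ over $K$. Put $\Delta=a^2-4b$ and $R(x)=x^3-3bx+ab$. Then $F$ contains a primitive cube root of unity $\zeta$, square roots $\sqrt\Delta$, $i\sqrt3=\sqrt{-3}$, $\sqrt{-3\Delta}$, and elements $\alpha,\beta$ with $\alpha^3=\frac{-a+\sqrt\Delta}2$, $\beta^3=\frac{-a-\sqrt\Delta}2$. For any such choice write $\sqrt[3]b=\alpha\beta$. "$b$ is a cube" means that some cube root of $b$ lies in $K$; "$\Delta=-3n^2$" means that this holds for some $n\in K$; "$\zeta\in K$" means that $K$ contains a primitive cube root of unity; "$R$ reducible" means not irreducible over $K$. Call an intermediate field $L$ of $F/K$ proper if $K\neq L\neq F$. If $b$ is a cube, then $R$ is irreducible. Hence the nine cases below are all the cases. In each of them $\operatorname{Gal}(F/K)$ is isomorphic to the stated group, the number of proper intermediate fields is as stated, and the displayed fields are pairwise distinct and are all the proper intermediate fields. They have the stated degrees over $K$; the fields marked (N) are normal over $K$ and the others are not. The list is valid for every choice of $\zeta,\sqrt\Delta,\sqrt{-3},\sqrt{-3\Delta},\alpha,\beta$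 as above, subject, where indicated, to an additional condition on $\alpha,\beta$; in these cases a choice satisfying the condition exists. **1. $\zeta\notin K$ and $\Delta\ne-3n^2$.** (1a) $b$ not a cube, $R$ reducible: group $D_6$ (dihedral of order 12), 14 fields. Choose $\alpha,\beta$ with $\alpha\beta(\alpha+\beta)\in K$. - Degree 2: $K(\sqrt\Delta), K(\zeta), K(\sqrt{-3\Delta})$ (N). - Degree 3: $K(\sqrt[3]b), K(\sqrt[3]b\,\zeta), K(\sqrt[3]b\,\zeta^2)$. - Degree 4: $K(\sqrt\Delta,\zeta)$ (N). - Degree 6: $K(\zeta,\sqrt[3]b)$ (N); $K(\alpha), K(\alpha\zeta), K(\alpha\zeta^2), K(\alpha\zeta+\beta\zeta^2), K(\alpha+\beta\zeta), K(\alpha+\beta\zeta^2)$. (1b) $b$ a cube, $R$ irreducible: group $D_6$, 14 fields. Choose $\alpha,\beta$ with $\alpha\beta\in K$. - Degree 2: $K(\sqrt\Delta), K(\zeta), K(\sqrt{-3\Delta})$ (N). - Degree 3: $K(\alpha+\beta), K(\alpha\zeta+\beta\zeta^2), K(\alpha\zeta^2+\beta\zeta)$. - Degree 4: $K(\sqrt\Delta,\zeta)$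 (N). - Degree 6: $K(\sqrt{-3\Delta},\alpha+\beta)$ (N); $K(\alpha), K(\alpha\zeta), K(\alpha\zeta^2), K(\zeta,\alpha+\beta), K(\zeta,\alpha\zeta+\beta\zeta^2), K(\zeta,\alpha\zeta^2+\beta\zeta)$. (1c) $b$ not a cube, $R$ irreducible: group $S_3\times S_3$, 58 fields. Write $\rho_0=\sqrt[3]b(\alpha+\beta)$, $\rho_1=\sqrt[3]b(\alpha\zeta+\beta\zeta^2)$, $\rho_2=\sqrt[3]b(\alpha\zeta^2+\beta\zeta)$, and let $i,k$ range over $\{0,1,2\}$. - Degree 2: $K(\zeta), K(\sqrt{-3\Delta}), K(\sqrt\Delta)$ (N). - Degree 3: $K(\sqrt[3]b\,\zeta^i)$, $K(\rho_i)$. - Degree 4: $K(\sqrt\Delta,\zeta)$ (N). - Degree 6: $K(\zeta,\sqrt[3]b), K(\sqrt{-3\Delta},\rho_0)$ (N); $K(\zeta,\rho_i)$, $K(\sqrt{-3\Delta},\sqrt[3]b\,\zeta^i)$, $K(\sqrt\Delta,\sqrt[3]b\,\zeta^i)$, $K(\sqrt\Delta,\rho_i)$, $K(\alpha\zeta^i)$,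 $K(\beta\zeta^i)$. - Degree 9: $K(\alpha+\beta), K(\alpha\zeta+\beta\zeta^2), K(\alpha\zeta^2+\beta\zeta), K((\alpha+\beta)\zeta^2), K(\alpha+\beta\zeta), K(\alpha\zeta+\beta), K((\alpha+\beta)\zeta), K(\alpha\zeta^2+\beta), K(\alpha+\beta\zeta^2)$. - Degree 12: $K(\sqrt\Delta,\zeta,\sqrt[3]b), K(\sqrt\Delta,\zeta,\rho_0)$ (N); $K(\zeta,\alpha), K(\zeta,\beta)$. - Degree 18: $K(\alpha\zeta^i,\beta\zeta^k)$ (nine fields), $K(\zeta,\alpha+\beta\zeta^i)$, $K(\zeta^i(\zeta-1)(\alpha-\beta))$. **2. $\zeta\notin K$ and $\Delta=-3n^2$.** (2a) $b$ not a cube, $R$ reducible: group $S_3$, 4 fields. - Degree 2: $K(i\sqrt3)$ (N). Degree 3: $K(\sqrt[3]b), K(\sqrt[3]b\,\zeta), K(\sqrt[3]b\,\zeta^2)$. (2b) $b$ a cube, $R$ irreducible: group $C_6$, 2 fields. Choose $\alpha,\beta$ with $\alpha\beta\in K$. - Degree 2: $K(i\sqrt3)$ (N). Degree 3: $K(\alpha+\beta)$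 (N). (2c) $b$ not a cube, $R$ irreducible: group $C_3\times S_3$, 12 fields. - Degree 2: $K(i\sqrt3)$ (N). - Degree 3: $K(\sqrt[3]b(\alpha+\beta))$ (N); $K(\sqrt[3]b), K(\sqrt[3]b\,\zeta), K(\sqrt[3]b\,\zeta^2)$. - Degree 6: $K(\zeta,\sqrt[3]b), K(\zeta,\sqrt[3]b(\alpha+\beta))$ (N); $K(\alpha), K(\beta)$. - Degree 9: $K(\alpha+\beta), K((\alpha+\beta)\zeta), K((\alpha+\beta)\zeta^2)$. **3. $\zeta\in K$.** (3a) $b$ not a cube, $R$ reducible: group $C_6$, 2 fields. - Degree 2: $K(\sqrt\Delta)$ (N). Degree 3: $K(\sqrt[3]b)$ (N). (3b) $b$ a cube, $R$ irreducible: group $S_3$, 4 fields. - Degree 2: $K(\sqrt\Delta)$ (N). Degree 3: $K(\alpha+\beta), K(\alpha\zeta+\beta\zeta^2), K(\alpha\zeta^2+\beta\zeta)$. (3c) $b$ not a cube, $R$ irreducible: group $C_3\times S_3$, 12 fields. - Degree 2: $K(\sqrt\Delta)$ (N). - Degree 3: $K(\sqrt[3]b)$ (N); $K(\sqrt[3]b(\alpha+\beta)),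 K(\sqrt[3]b(\alpha\zeta+\beta\zeta^2)), K(\sqrt[3]b(\alpha\zeta^2+\beta\zeta))$. - Degree 6: $K(\sqrt\Delta,\sqrt[3]b(\alpha+\beta)), K(\sqrt\Delta,\sqrt[3]b)$ (N); $K(\alpha), K(\beta)$. - Degree 9: $K(\alpha+\beta), K(\alpha\zeta+\beta\zeta^2), K(\alpha\zeta^2+\beta\zeta)$. -/

import Mathlib

open Polynomial IntermediateField

namespace SexticTrinomial

universe u v

/-- The trinomial `x ^ 6 + a x ^ 3 + b`. -/
noncomputable def sextic {K : Type u} [Field K] (a b : K) : K[X] :=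
  X ^ 6 + C a * X ^ 3 + C b

/-- The cubic `R(x) = x ^ 3 - 3 b x + a b`. -/
noncomputable def cubicR {K : Type u} [Field K] (a b : K) : K[X] :=
  X ^ 3 - C (3 * b) * X + C (a * b)

/-- `K` contains a primitive cube root of unity. -/
def HasZeta (K : Type u) [Field K] : Prop := ∃ z : K, IsPrimitiveRoot z 3

/-- At least one of the cube roots of `b` lies in `K`. -/
def IsCubeIn {K : Type u} [Field K] (b : K) : Prop := ∃ x : K, x ^ 3 = b

/-- The discriminant `a ^ 2 - 4 b` has the form `- 3 n ^ 2` with `n` in `K`. -/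
def DeltaIsNegThreeSq {K : Type u} [Field K] (a b : K) : Prop :=
  ∃ n : K, a ^ 2 - 4 * b = -3 * n ^ 2

/-- A choice in `F` of the radicals attached to `x ^ 6 + a x ^ 3 + b`, where
`Δ = a ^ 2 - 4 b`: a primitive cube root of unity `ζ`, square roots of `Δ`, `-3` and `-3 Δ`,
and cube roots `α`, `β` of the two numbers `(- a ± √Δ) / 2`. -/
structure Radicals {K : Type u} [Field K] (F : Type v) [Field F] [Algebra K F] (a b : K) where
  ζ : F
  sqrtDelta : F
  sqrtNegThree : F
  sqrtNegThreeDelta : F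
  α : F
  β : F
  isPrimitiveRoot_ζ : IsPrimitiveRoot ζ 3
  sqrtDelta_sq : sqrtDelta ^ 2 = algebraMap K F (a ^ 2 - 4 * b)
  sqrtNegThree_sq : sqrtNegThree ^ 2 = -3
  sqrtNegThreeDelta_sq : sqrtNegThreeDelta ^ 2 = algebraMap K F (-3 * (a ^ 2 - 4 * b))
  α_cube : α ^ 3 = (-algebraMap K F a + sqrtDelta) / 2
  β_cube : β ^ 3 = (-algebraMap K F a - sqrtDelta) / 2

/-- One row of a list of intermediate fields: fields of a given degree over `K`, first those
that are asserted to be normal over `K`, then those that are asserted not to be. -/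
structure Row (K : Type u) (F : Type v) [Field K] [Field F] [Algebra K F] where
  degree : ℕ
  normal : List (IntermediateField K F)
  nonNormal : List (IntermediateField K F)

/-- All the fields of a row. -/
def Row.fields {K : Type u} {F : Type v} [Field K] [Field F] [Algebra K F] (r : Row K F) :
    List (IntermediateField K F) :=
  r.normal ++ r.nonNormal

/-- The intermediate fields `L` with `K < L < F`. -/
def properSubfields (K : Type u) (F : Type v) [Field K] [Field F] [Algebra K F] :
    Set (IntermediateField K F) :=
  {L | L ≠ ⊥ ∧ L ≠ ⊤}

/-- `T` lists every field strictly between `K` and `F` exactly once, with the correct degree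
over `K` and with the correct indication of whether it is normal over `K`. -/
structure IsCompleteList {K : Type u} {F : Type v} [Field K] [Field F] [Algebra K F]
    (T : List (Row K F)) : Prop where
  nodup : (T.flatMap Row.fields).Nodup
  mem_iff : ∀ L : IntermediateField K F, L ∈ T.flatMap Row.fields ↔ L ∈ properSubfields K F
  degree : ∀ r ∈ T, ∀ L ∈ r.fields, Module.finrank K L = r.degree
  normal : ∀ r ∈ T, ∀ L ∈ r.normal, Normal K L
  not_normal : ∀ r ∈ T, ∀ L ∈ r.nonNormal, ¬ Normal K L

namespace Radicals

variable {K : Type u} {F : Type v} [Field K] [Field F] [Algebra K F] {a b : K}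

/-- The cube root of `b` given by `α β`. -/
def cbrt (r : Radicals F a b) : F := r.α * r.β

/-- `cbrt b` lies in `K` for this choice of `α` and `β`. -/
def CbrtMem (r : Radicals F a b) : Prop := r.cbrt ∈ (algebraMap K F).range

/-- The root `cbrt b * (α + β)` of `R` lies in `K` for this choice of `α` and `β`. -/
def RootRMem (r : Radicals F a b) : Prop := r.cbrt * (r.α + r.β) ∈ (algebraMap K F).range

/-- `ζ ∉ K`, `Δ ≠ - 3 n ^ 2`, `cbrt b ∉ K`, `R` reducible (group `D₆`). -/
def listD6NotCube (r : Radicals F a b) : List (Row K F) :=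
  [ ⟨2, [K⟮r.sqrtDelta⟯, K⟮r.ζ⟯, K⟮r.sqrtNegThreeDelta⟯], []⟩,
    ⟨3, [], [K⟮r.cbrt⟯, K⟮r.cbrt * r.ζ⟯, K⟮r.cbrt * r.ζ ^ 2⟯]⟩,
    ⟨4, [K⟮r.sqrtDelta, r.ζ⟯], []⟩,
    ⟨6, [K⟮r.ζ, r.cbrt⟯],
      [K⟮r.α⟯, K⟮r.α * r.ζ⟯, K⟮r.α * r.ζ ^ 2⟯,
        K⟮r.α * r.ζ + r.β * r.ζ ^ 2⟯, K⟮r.α + r.β * r.ζ⟯, K⟮r.α + r.β * r.ζ ^ 2⟯]⟩ ]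

/-- `ζ ∉ K`, `Δ ≠ - 3 n ^ 2`, `cbrt b ∈ K`, `R` irreducible (group `D₆`). -/
def listD6Cube (r : Radicals F a b) : List (Row K F) :=
  [ ⟨2, [K⟮r.sqrtDelta⟯, K⟮r.ζ⟯, K⟮r.sqrtNegThreeDelta⟯], []⟩,
    ⟨3, [], [K⟮r.α + r.β⟯, K⟮r.α * r.ζ + r.β * r.ζ ^ 2⟯, K⟮r.α * r.ζ ^ 2 + r.β * r.ζ⟯]⟩,
    ⟨4, [K⟮r.sqrtDelta, r.ζ⟯], []⟩,
    ⟨6, [K⟮r.sqrtNegThreeDelta, r.α + r.β⟯],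
      [K⟮r.α⟯, K⟮r.α * r.ζ⟯, K⟮r.α * r.ζ ^ 2⟯,
        K⟮r.ζ, r.α + r.β⟯, K⟮r.ζ, r.α * r.ζ + r.β * r.ζ ^ 2⟯,
        K⟮r.ζ, r.α * r.ζ ^ 2 + r.β * r.ζ⟯]⟩ ]

/-- `ζ ∉ K`, `Δ ≠ - 3 n ^ 2`, `cbrt b ∉ K`, `R` irreducible (group `S₃ × S₃`). -/
def listS3S3 (r : Radicals F a b) : List (Row K F) :=
  [ ⟨2, [K⟮r.ζ⟯, K⟮r.sqrtNegThreeDelta⟯, K⟮r.sqrtDelta⟯], []⟩,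
    ⟨3, [],
      [K⟮r.cbrt⟯, K⟮r.cbrt * r.ζ⟯, K⟮r.cbrt * r.ζ ^ 2⟯,
        K⟮r.cbrt * (r.α + r.β)⟯, K⟮r.cbrt * (r.α * r.ζ + r.β * r.ζ ^ 2)⟯,
        K⟮r.cbrt * (r.α * r.ζ ^ 2 + r.β * r.ζ)⟯]⟩,
    ⟨4, [K⟮r.sqrtDelta, r.ζ⟯], []⟩,
    ⟨6, [K⟮r.ζ, r.cbrt⟯, K⟮r.sqrtNegThreeDelta, r.cbrt * (r.α + r.β)⟯],
      [K⟮r.ζ, r.cbrt * (r.α + r.β)⟯, K⟮r.ζ, r.cbrt * (r.α * r.ζ + r.β * r.ζ ^ 2)⟯,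
        K⟮r.ζ, r.cbrt * (r.α * r.ζ ^ 2 + r.β * r.ζ)⟯,
        K⟮r.sqrtNegThreeDelta, r.cbrt⟯, K⟮r.sqrtNegThreeDelta, r.cbrt * r.ζ⟯,
        K⟮r.sqrtNegThreeDelta, r.cbrt * r.ζ ^ 2⟯,
        K⟮r.sqrtDelta, r.cbrt⟯, K⟮r.sqrtDelta, r.cbrt * r.ζ⟯, K⟮r.sqrtDelta, r.cbrt * r.ζ ^ 2⟯,
        K⟮r.sqrtDelta, r.cbrt * (r.α + r.β)⟯,
        K⟮r.sqrtDelta, r.cbrt * (r.α * r.ζ + r.β * r.ζ ^ 2)⟯,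
        K⟮r.sqrtDelta, r.cbrt * (r.α * r.ζ ^ 2 + r.β * r.ζ)⟯,
        K⟮r.α⟯, K⟮r.α * r.ζ⟯, K⟮r.α * r.ζ ^ 2⟯, K⟮r.β⟯, K⟮r.β * r.ζ⟯, K⟮r.β * r.ζ ^ 2⟯]⟩,
    ⟨9, [],
      [K⟮r.α + r.β⟯, K⟮r.α * r.ζ + r.β * r.ζ ^ 2⟯, K⟮r.α * r.ζ ^ 2 + r.β * r.ζ⟯,
        K⟮(r.α + r.β) * r.ζ ^ 2⟯, K⟮r.α + r.β * r.ζ⟯, K⟮r.α * r.ζ + r.β⟯,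
        K⟮(r.α + r.β) * r.ζ⟯, K⟮r.α * r.ζ ^ 2 + r.β⟯, K⟮r.α + r.β * r.ζ ^ 2⟯]⟩,
    ⟨12, [K⟮r.sqrtDelta, r.ζ, r.cbrt⟯, K⟮r.sqrtDelta, r.ζ, r.cbrt * (r.α + r.β)⟯],
      [K⟮r.ζ, r.α⟯, K⟮r.ζ, r.β⟯]⟩,
    ⟨18, [],
      [K⟮r.α, r.β⟯, K⟮r.α, r.β * r.ζ⟯, K⟮r.α, r.β * r.ζ ^ 2⟯,
        K⟮r.α * r.ζ, r.β⟯, K⟮r.α * r.ζ, r.β * r.ζ⟯, K⟮r.α * r.ζ, r.β * r.ζ ^ 2⟯,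
        K⟮r.α * r.ζ ^ 2, r.β⟯, K⟮r.α * r.ζ ^ 2, r.β * r.ζ⟯,
        K⟮r.α * r.ζ ^ 2, r.β * r.ζ ^ 2⟯,
        K⟮r.ζ, r.α + r.β⟯, K⟮r.ζ, r.α + r.β * r.ζ⟯, K⟮r.ζ, r.α + r.β * r.ζ ^ 2⟯,
        K⟮(r.ζ - 1) * (r.α - r.β)⟯, K⟮r.ζ * (r.ζ - 1) * (r.α - r.β)⟯,
        K⟮r.ζ ^ 2 * (r.ζ - 1) * (r.α - r.β)⟯]⟩ ]

/-- `ζ ∉ K`, `Δ = - 3 n ^ 2`, `cbrt b ∉ K`, `R` reducible (group `S₃`). -/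
def listS3NoZeta (r : Radicals F a b) : List (Row K F) :=
  [ ⟨2, [K⟮r.sqrtNegThree⟯], []⟩,
    ⟨3, [], [K⟮r.cbrt⟯, K⟮r.cbrt * r.ζ⟯, K⟮r.cbrt * r.ζ ^ 2⟯]⟩ ]

/-- `ζ ∉ K`, `Δ = - 3 n ^ 2`, `cbrt b ∈ K`, `R` irreducible (group `C₆`). -/
def listC6NoZeta (r : Radicals F a b) : List (Row K F) :=
  [ ⟨2, [K⟮r.sqrtNegThree⟯], []⟩,
    ⟨3, [K⟮r.α + r.β⟯], []⟩ ]

/-- `ζ ∉ K`, `Δ = - 3 n ^ 2`, `cbrt b ∉ K`, `R` irreducible (group `C₃ × S₃`). -/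
def listC3S3NoZeta (r : Radicals F a b) : List (Row K F) :=
  [ ⟨2, [K⟮r.sqrtNegThree⟯], []⟩,
    ⟨3, [K⟮r.cbrt * (r.α + r.β)⟯], [K⟮r.cbrt⟯, K⟮r.cbrt * r.ζ⟯, K⟮r.cbrt * r.ζ ^ 2⟯]⟩,
    ⟨6, [K⟮r.ζ, r.cbrt⟯, K⟮r.ζ, r.cbrt * (r.α + r.β)⟯], [K⟮r.α⟯, K⟮r.β⟯]⟩,
    ⟨9, [], [K⟮r.α + r.β⟯, K⟮(r.α + r.β) * r.ζ⟯, K⟮(r.α + r.β) * r.ζ ^ 2⟯]⟩ ]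

/-- `ζ ∈ K`, `cbrt b ∉ K`, `R` reducible (group `C₆`). -/
def listC6Zeta (r : Radicals F a b) : List (Row K F) :=
  [ ⟨2, [K⟮r.sqrtDelta⟯], []⟩,
    ⟨3, [K⟮r.cbrt⟯], []⟩ ]

/-- `ζ ∈ K`, `cbrt b ∈ K`, `R` irreducible (group `S₃`). -/
def listS3Zeta (r : Radicals F a b) : List (Row K F) :=
  [ ⟨2, [K⟮r.sqrtDelta⟯], []⟩,
    ⟨3, [], [K⟮r.α + r.β⟯, K⟮r.α * r.ζ + r.β * r.ζ ^ 2⟯, K⟮r.α * r.ζ ^ 2 + r.β * r.ζ⟯]⟩ ]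

/-- `ζ ∈ K`, `cbrt b ∉ K`, `R` irreducible (group `C₃ × S₃`). -/
def listC3S3Zeta (r : Radicals F a b) : List (Row K F) :=
  [ ⟨2, [K⟮r.sqrtDelta⟯], []⟩,
    ⟨3, [K⟮r.cbrt⟯],
      [K⟮r.cbrt * (r.α + r.β)⟯, K⟮r.cbrt * (r.α * r.ζ + r.β * r.ζ ^ 2)⟯,
        K⟮r.cbrt * (r.α * r.ζ ^ 2 + r.β * r.ζ)⟯]⟩,
    ⟨6, [K⟮r.sqrtDelta, r.cbrt * (r.α + r.β)⟯, K⟮r.sqrtDelta, r.cbrt⟯], [K⟮r.α⟯, K⟮r.β⟯]⟩,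
    ⟨9, [],
      [K⟮r.α + r.β⟯, K⟮r.α * r.ζ + r.β * r.ζ ^ 2⟯, K⟮r.α * r.ζ ^ 2 + r.β * r.ζ⟯]⟩ ]

end Radicals

end SexticTrinomial

namespace SexticTrinomial

/-! Put c = αβ, a cube root of b. By Cardano's formula (`Radicals.cubicR_prod`) the roots of R are
ρ_k = c(αζ^k + βζ^(2k)), and F is the compositum of the splitting fields of x³ - b and of R. Their
discriminants are -27b² and -27b²Δ, so the quadratic subfields attached to them are generated by ζ
and by √(-3Δ). Hence Gal(F/K) embeds in S₃ × S₃ through its actions on these two triples of roots.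
Concretely, an automorphism is determined by what it does to ζ, α and β, which leaves 36 possible
codes.

The theorem thus becomes a question about subgroups of a group of order 36. Such a subgroup is
stored as a bit mask; `exists_mem_subgroupMasks` shows that the sixty masks in `subgroupMasks` are
all of them. Irreducibility of f makes the mask of the Galois group transitive
(`Radicals.transMask_eq_true`), and `Radicals.exists_mask` turns the conditions on ζ, Δ, b and R
into conditions on fixed symbols. In each case the lemmas `completeFor_*` and `isoCode_*` then
verify the list and the group by evaluation over the sixty masks. The Galois correspondence carries
the result back to fields in `Radicals.isCompleteList` and `Radicals.nonempty_mulEquiv`.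

The bridge is `Radicals.FixOK`: an automorphism fixes a generator exactly when its code fixes the
corresponding formal expression. For sums and differences of α and β this needs α³ ≠ ±β³. The sign +
is excluded by Δ ≠ 0, the sign - by a ≠ 0. If a = 0 then 0 is a root of R, so only the reducible
cases remain. Among these only the D₆ list contains sums, and there the choice of radicals forces β
= -α, where the sums that occur can still be told apart. -/

/-! ### Codes of automorphisms

The code `18 s + 9 t + 3 i + j` stands for the substitution `ζ ↦ ζ ^ (1 + t)`,
`α ↦ ζ ^ i α`, `β ↦ ζ ^ j β` if `s = 0` and `ζ ↦ ζ ^ (1 + t)`, `α ↦ ζ ^ i β`, `β ↦ ζ ^ j α`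
if `s = 1`. -/

/-- The code with the given components. -/
def mkCode (s t i j : ℕ) : ℕ := 18 * s + 9 * t + 3 * i + j

/-- Whether `α` and `β` are interchanged. -/
def sOf (g : ℕ) : ℕ := g / 18

/-- Whether `ζ` is inverted. -/
def tOf (g : ℕ) : ℕ := g / 9 % 2

/-- The exponent of `ζ` in the image of `α`. -/
def iOf (g : ℕ) : ℕ := g / 3 % 3

/-- The exponent of `ζ` in the image of `β`. -/
def jOf (g : ℕ) : ℕ := g % 3

/-- The code of the composition of two substitutions. -/
def mulCode (g h : ℕ) : ℕ :=
  mkCode ((sOf g + sOf h) % 2) ((tOf g + tOf h) % 2)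
    (((1 + tOf g) * iOf h + if sOf h = 0 then iOf g else jOf g) % 3)
    (((1 + tOf g) * jOf h + if sOf h = 0 then jOf g else iOf g) % 3)

/-- The code of the inverse substitution. -/
def invCode (g : ℕ) : ℕ :=
  mulCode (mulCode (mulCode g g) (mulCode g g)) g

/-- The codes in a mask. -/
def bits (m : ℕ) : List ℕ := (List.range 36).filter (Nat.testBit m)

/-- The mask of a list of codes. -/
def maskOf (l : List ℕ) : ℕ := l.foldr (fun n acc => 2 ^ n ||| acc) 0

theorem testBit_maskOf (l : List ℕ) (x : ℕ) : (maskOf l).testBit x = true ↔ x ∈ l := by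
  induction l with
  | nil => simp [maskOf]
  | cons n l ih =>
    have : maskOf (n :: l) = 2 ^ n ||| maskOf l := rfl
    rw [this, Nat.testBit_or, Bool.or_eq_true, ih, Nat.testBit_two_pow]
    simp [eq_comm]

theorem mem_bits {m x : ℕ} : x ∈ bits m ↔ x < 36 ∧ m.testBit x = true := by
  simp [bits]

/-- The union of `M`, `g M` and `g ^ 2 M`. -/
def extMask (M g : ℕ) : ℕ :=
  M ||| maskOf ((bits M).map (mulCode g)) ||| maskOf ((bits M).map (mulCode (mulCode g g)))

/-- Whether the mask is closed under composition. -/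
def closedMask (M : ℕ) : Bool :=
  (bits M).all fun x => (bits M).all fun y => M.testBit (mulCode x y)

/-- From the masks of subgroups inside the codes below `lo` to those inside the codes
below `hi`. -/
def extendMasks (lo hi : ℕ) (L : List ℕ) : List ℕ :=
  (L ++ (L.flatMap fun M => ((List.range hi).filter (lo ≤ ·)).map (extMask M))).dedup.filter
    closedMask

/-- The masks of all sets of codes containing `0` and closed under composition. -/
def subgroupMasks : List ℕ :=
  [ 1, 7, 73, 161, 273, 511, 513, 1025, 2049, 4097, 8193, 16385, 32769, 65537, 131073, 3591, 28679,
    229383, 37449, 74825, 149577, 43169, 82593, 136353, 50449, 71953, 140049, 262143, 262145,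
    8388609, 33554433, 134217729, 2147483649, 34359738369, 42205345, 11274289313, 21609054369,
    35701915809, 25690385, 36700433, 71565585, 36641440017, 133956095, 68585259519, 134480385,
    34393293825, 2155874305, 34368131073, 2147753985, 167788545, 2181070849, 142671873, 34360131585,
    11316537505, 21651341985, 35744257185, 36678190353, 36667201809, 36713145105, 68719476735 ]

/-- The codes below 1, 3, 9, 18 and 36 form a chain of subgroups. Its successive indices 3, 3, 2, 2
are prime, so a subgroup can be rebuilt layer by layer by adjoining at most one new element at a
time. -/
theorem extendMasks_eq_subgroupMasks :
    extendMasks 18 36 (extendMasks 9 18 (extendMasks 3 9 (extendMasks 1 3 [1]))) =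
      subgroupMasks := by decide +kernel

/-- The three consecutive pairs of bounds between which codes form one layer. -/
def IsLayer (lo hi : ℕ) : Prop :=
  (lo = 1 ∧ hi = 3) ∨ (lo = 3 ∧ hi = 9) ∨ (lo = 9 ∧ hi = 18) ∨ (lo = 18 ∧ hi = 36)

theorem layer_closed {lo hi : ℕ} (h : IsLayer lo hi) :
    ∀ x < hi, ∀ y < hi, mulCode x y < hi := by
  rcases h with ⟨rfl, rfl⟩ | ⟨rfl, rfl⟩ | ⟨rfl, rfl⟩ | ⟨rfl, rfl⟩ <;> decide +kernel

/-- The lower subgroup has index 2 or 3 and is normal, so the cosets other than itself are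
represented by g and g ^ 2 for any g outside it. -/
theorem layer_coset {lo hi : ℕ} (h : IsLayer lo hi) :
    ∀ g < hi, lo ≤ g → ∀ x < hi, lo ≤ x →
      mulCode (invCode g) x < lo ∨ mulCode (invCode g) (mulCode (invCode g) x) < lo := by
  rcases h with ⟨rfl, rfl⟩ | ⟨rfl, rfl⟩ | ⟨rfl, rfl⟩ | ⟨rfl, rfl⟩ <;> decide +kernel

/-- The group of codes has exponent 6, so the fifth power used as `invCode` is an inverse. -/
theorem mulCode_mulCode_invCode : ∀ g < 36, ∀ x < 36,
    mulCode g (mulCode (invCode g) x) = x := by decide +kernel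

theorem mulCode_mulCode_mulCode_invCode : ∀ g < 36, ∀ x < 36,
    mulCode (mulCode g g) (mulCode (invCode g) (mulCode (invCode g) x)) = x := by
  decide +kernel

theorem testBit_extMask {M g x : ℕ} :
    (extMask M g).testBit x = true ↔ M.testBit x = true ∨
      (∃ y < 36, M.testBit y = true ∧ mulCode g y = x) ∨
      ∃ y < 36, M.testBit y = true ∧ mulCode (mulCode g g) y = x := by
  simp only [extMask, Nat.testBit_or, Bool.or_eq_true, testBit_maskOf, List.mem_map, mem_bits,
    and_assoc, or_assoc]

/-- If T meets the new layer in some g, its part below `hi` is M ∪ gM ∪ g²M, where M is its part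
below `lo`; otherwise it is M. The filter by `closedMask` cannot discard such a mask, because T is
closed. -/
theorem exists_mem_extendMasks {T : ℕ → Prop} (hmul : ∀ x y, T x → T y → T (mulCode x y))
    {lo hi : ℕ} (h : IsLayer lo hi) {L : List ℕ}
    (hL : ∃ m ∈ L, ∀ x, m.testBit x = true ↔ T x ∧ x < lo) :
    ∃ m ∈ extendMasks lo hi L, ∀ x, m.testBit x = true ↔ T x ∧ x < hi := by
  obtain ⟨M, hM, hMT⟩ := hL
  have hlh : lo < hi ∧ hi ≤ 36 := by unfold IsLayer at h; omega
  have key : ∃ m ∈ (L ++ (L.flatMap fun M =>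
      ((List.range hi).filter (lo ≤ ·)).map (extMask M))).dedup,
      ∀ x, m.testBit x = true ↔ T x ∧ x < hi := by
    simp only [List.mem_dedup, List.mem_append, List.mem_flatMap, List.mem_map, List.mem_filter,
      List.mem_range, decide_eq_true_eq]
    by_cases hg : ∃ g, T g ∧ lo ≤ g ∧ g < hi
    · obtain ⟨g, hTg, hlg, hgh⟩ := hg
      refine ⟨extMask M g, .inr ⟨M, hM, g, ⟨hgh, hlg⟩, rfl⟩, fun x => ?_⟩
      -- Inverses are positive powers here, so closure under composition already gives closure under
      -- inversion.
      have hinv : T (invCode g) :=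
        hmul _ _ (hmul _ _ (hmul _ _ hTg hTg) (hmul _ _ hTg hTg)) hTg
      rw [testBit_extMask]
      constructor
      · rintro (hx | ⟨y, -, hy, rfl⟩ | ⟨y, -, hy, rfl⟩)
        · exact ⟨((hMT x).1 hx).1, ((hMT x).1 hx).2.trans hlh.1⟩
        · obtain ⟨hy, hyl⟩ := (hMT y).1 hy
          exact ⟨hmul _ _ hTg hy, layer_closed h _ hgh _ (hyl.trans hlh.1)⟩
        · obtain ⟨hy, hyl⟩ := (hMT y).1 hy
          exact ⟨hmul _ _ (hmul _ _ hTg hTg) hy,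
            layer_closed h _ (layer_closed h _ hgh _ hgh) _ (hyl.trans hlh.1)⟩
      · rintro ⟨hTx, hxh⟩
        by_cases hxl : x < lo
        · exact .inl ((hMT x).2 ⟨hTx, hxl⟩)
        · refine .inr ?_
          have h1 : T (mulCode (invCode g) x) := hmul _ _ hinv hTx
          rcases layer_coset h g hgh hlg x hxh (not_lt.1 hxl) with h' | h'
          · exact .inl ⟨_, by omega, (hMT _).2 ⟨h1, h'⟩,
              mulCode_mulCode_invCode g (by omega) x (by omega)⟩
          · exact .inr ⟨_, by omega, (hMT _).2 ⟨hmul _ _ hinv h1, h'⟩,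
              mulCode_mulCode_mulCode_invCode g (by omega) x (by omega)⟩
    · refine ⟨M, .inl hM, fun x => (hMT x).trans
        ⟨fun hx => ⟨hx.1, hx.2.trans hlh.1⟩, fun hx => ⟨hx.1, ?_⟩⟩⟩
      by_contra hlx
      exact hg ⟨x, hx.1, not_lt.1 hlx, hx.2⟩
  obtain ⟨m, hm, hmT⟩ := key
  refine ⟨m, ?_, hmT⟩
  rw [extendMasks, List.mem_filter]
  refine ⟨hm, ?_⟩
  simp only [closedMask, List.all_eq_true, mem_bits, hmT]
  exact fun x hx y hy => ⟨hmul _ _ hx.2.1 hy.2.1, layer_closed h _ hx.2.2 _ hy.2.2⟩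

theorem exists_mem_subgroupMasks {T : ℕ → Prop} (h0 : T 0)
    (hmul : ∀ x y, T x → T y → T (mulCode x y)) (hlt : ∀ x, T x → x < 36) :
    ∃ m ∈ subgroupMasks, ∀ x, m.testBit x = true ↔ T x := by
  have h1 : ∃ m ∈ [1], ∀ x, m.testBit x = true ↔ T x ∧ x < 1 := by
    refine ⟨1, by simp, fun x => ?_⟩
    rw [Nat.testBit_one_eq_true_iff_self_eq_zero]
    exact ⟨by rintro rfl; exact ⟨h0, by simp⟩, fun h => by omega⟩
  obtain ⟨m, hm, hmT⟩ := exists_mem_extendMasks hmul (.inr (.inr (.inr ⟨rfl, rfl⟩)))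
    (exists_mem_extendMasks hmul (.inr (.inr (.inl ⟨rfl, rfl⟩)))
      (exists_mem_extendMasks hmul (.inr (.inl ⟨rfl, rfl⟩))
        (exists_mem_extendMasks hmul (.inl ⟨rfl, rfl⟩) h1)))
  exact ⟨m, extendMasks_eq_subgroupMasks ▸ hm, fun x => (hmT x).trans
    ⟨fun h => h.1, fun h => ⟨h, hlt x h⟩⟩⟩

/-! ### Symbolic generators -/

/-- Symbols for the generators of the intermediate fields. -/
inductive Sym
  | sqrtDelta | zeta | sqrtNegThree | sqrtNegThreeDelta
  | cbrt (k : Fin 3)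
  | rho (k : Fin 3)
  | alpha (k : Fin 3)
  | beta (k : Fin 3)
  | sum (u v : Fin 3)
  | diff (k : Fin 3)

/-- Whether the substitution with code `g` fixes the formal sum `α ζ ^ u + β ζ ^ v` after
multiplication by `ζ ^ d`. -/
def fixesSum (d u v g : ℕ) : Bool :=
  if sOf g = 0 then
    (d + iOf g + (1 + tOf g) * u) % 3 == u && (d + jOf g + (1 + tOf g) * v) % 3 == v
  else
    (d + iOf g + (1 + tOf g) * u) % 3 == v && (d + jOf g + (1 + tOf g) * v) % 3 == u

/-- Whether the substitution with the given code fixes the given generator. -/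
def Sym.fixes : Sym → ℕ → Bool
  | sqrtDelta, g => sOf g == 0
  | zeta, g => tOf g == 0
  | sqrtNegThree, g => tOf g == 0
  | sqrtNegThreeDelta, g => sOf g == tOf g
  | cbrt k, g => (iOf g + jOf g + (1 + tOf g) * k) % 3 == k
  | rho k, g => fixesSum (iOf g + jOf g) k (2 * k % 3) g
  | alpha k, g => sOf g == 0 && (iOf g + (1 + tOf g) * k) % 3 == k
  | beta k, g => sOf g == 0 && (jOf g + (1 + tOf g) * k) % 3 == k
  | sum u v, g => fixesSum 0 u v g
  | diff k, g => sOf g == tOf g && fixesSum (2 * tOf g) k k g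

/-- The mask of the codes fixing all generators in a list. -/
def stabMask (l : List Sym) : ℕ :=
  maskOf ((List.range 36).filter fun g => l.all fun s => s.fixes g)

theorem testBit_stabMask {l : List Sym} {g : ℕ} :
    (stabMask l).testBit g = true ↔ g < 36 ∧ ∀ s ∈ l, s.fixes g = true := by
  simp [stabMask, testBit_maskOf]

/-! ### Lists of fields -/

/-- The symbolic form of a row. -/
structure SymRow where
  degree : ℕ
  normal : List (List Sym)
  nonNormal : List (List Sym)

/-- Whether the mask `m` is that of a normal subgroup in `H`. -/
def normalMask (H m : ℕ) : Bool :=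
  (bits m).all fun x => (bits H).all fun h => m.testBit (mulCode (mulCode h x) (invCode h))

/-- The masks of the subgroups of `H` fixing the fields in a symbolic row. -/
def SymRow.masks (H : ℕ) (R : SymRow) : List ℕ :=
  (R.normal ++ R.nonNormal).map fun l => H &&& stabMask l

/-- Whether the symbolic list has the properties demanded of a complete list of the proper
intermediate fields when `H` is the mask of the full Galois group. -/
def completeFor (H : ℕ) (T : List SymRow) : Bool :=
  let masks := T.flatMap (SymRow.masks H)
  decide masks.Nodup &&
  (masks.all fun m => m != 1 && m != H) &&
  (subgroupMasks.all fun m => !(H &&& m == m) || m == 1 || m == H || masks.contains m) &&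
  T.all fun R =>
    ((R.masks H).all fun m => (bits H).length == R.degree * (bits m).length) &&
    (R.normal.all fun l => normalMask H (H &&& stabMask l)) &&
    (R.nonNormal.all fun l => !normalMask H (H &&& stabMask l))

/-- The symbolic form of `Radicals.listD6NotCube`. -/
def symD6NotCube : List SymRow :=
  [ ⟨2, [[.sqrtDelta], [.zeta], [.sqrtNegThreeDelta]], []⟩,
    ⟨3, [], [[.cbrt 0], [.cbrt 1], [.cbrt 2]]⟩,
    ⟨4, [[.sqrtDelta, .zeta]], []⟩,
    ⟨6, [[.zeta, .cbrt 0]],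
      [[.alpha 0], [.alpha 1], [.alpha 2], [.sum 1 2], [.sum 0 1], [.sum 0 2]]⟩ ]

/-- The symbolic form of `Radicals.listD6Cube`. -/
def symD6Cube : List SymRow :=
  [ ⟨2, [[.sqrtDelta], [.zeta], [.sqrtNegThreeDelta]], []⟩,
    ⟨3, [], [[.sum 0 0], [.sum 1 2], [.sum 2 1]]⟩,
    ⟨4, [[.sqrtDelta, .zeta]], []⟩,
    ⟨6, [[.sqrtNegThreeDelta, .sum 0 0]],
      [[.alpha 0], [.alpha 1], [.alpha 2],
        [.zeta, .sum 0 0], [.zeta, .sum 1 2], [.zeta, .sum 2 1]]⟩ ]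

/-- The symbolic form of `Radicals.listS3S3`. -/
def symS3S3 : List SymRow :=
  [ ⟨2, [[.zeta], [.sqrtNegThreeDelta], [.sqrtDelta]], []⟩,
    ⟨3, [], [[.cbrt 0], [.cbrt 1], [.cbrt 2], [.rho 0], [.rho 1], [.rho 2]]⟩,
    ⟨4, [[.sqrtDelta, .zeta]], []⟩,
    ⟨6, [[.zeta, .cbrt 0], [.sqrtNegThreeDelta, .rho 0]],
      [[.zeta, .rho 0], [.zeta, .rho 1], [.zeta, .rho 2],
        [.sqrtNegThreeDelta, .cbrt 0], [.sqrtNegThreeDelta, .cbrt 1], [.sqrtNegThreeDelta, .cbrt 2],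
        [.sqrtDelta, .cbrt 0], [.sqrtDelta, .cbrt 1], [.sqrtDelta, .cbrt 2],
        [.sqrtDelta, .rho 0], [.sqrtDelta, .rho 1], [.sqrtDelta, .rho 2],
        [.alpha 0], [.alpha 1], [.alpha 2], [.beta 0], [.beta 1], [.beta 2]]⟩,
    ⟨9, [],
      [[.sum 0 0], [.sum 1 2], [.sum 2 1], [.sum 2 2], [.sum 0 1], [.sum 1 0],
        [.sum 1 1], [.sum 2 0], [.sum 0 2]]⟩,
    ⟨12, [[.sqrtDelta, .zeta, .cbrt 0], [.sqrtDelta, .zeta, .rho 0]],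
      [[.zeta, .alpha 0], [.zeta, .beta 0]]⟩,
    ⟨18, [],
      [[.alpha 0, .beta 0], [.alpha 0, .beta 1], [.alpha 0, .beta 2],
        [.alpha 1, .beta 0], [.alpha 1, .beta 1], [.alpha 1, .beta 2],
        [.alpha 2, .beta 0], [.alpha 2, .beta 1], [.alpha 2, .beta 2],
        [.zeta, .sum 0 0], [.zeta, .sum 0 1], [.zeta, .sum 0 2],
        [.diff 0], [.diff 1], [.diff 2]]⟩ ]
/-- The symbolic form of `Radicals.listS3NoZeta`. -/
def symS3NoZeta : List SymRow :=
  [ ⟨2, [[.sqrtNegThree]], []⟩, ⟨3, [], [[.cbrt 0], [.cbrt 1], [.cbrt 2]]⟩ ]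

/-- The symbolic form of `Radicals.listC6NoZeta`. -/
def symC6NoZeta : List SymRow :=
  [ ⟨2, [[.sqrtNegThree]], []⟩, ⟨3, [[.sum 0 0]], []⟩ ]

/-- The symbolic form of `Radicals.listC3S3NoZeta`. -/
def symC3S3NoZeta : List SymRow :=
  [ ⟨2, [[.sqrtNegThree]], []⟩,
    ⟨3, [[.rho 0]], [[.cbrt 0], [.cbrt 1], [.cbrt 2]]⟩,
    ⟨6, [[.zeta, .cbrt 0], [.zeta, .rho 0]], [[.alpha 0], [.beta 0]]⟩,
    ⟨9, [], [[.sum 0 0], [.sum 1 1], [.sum 2 2]]⟩ ]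

/-- The symbolic form of `Radicals.listC6Zeta`. -/
def symC6Zeta : List SymRow :=
  [ ⟨2, [[.sqrtDelta]], []⟩, ⟨3, [[.cbrt 0]], []⟩ ]

/-- The symbolic form of `Radicals.listS3Zeta`. -/
def symS3Zeta : List SymRow :=
  [ ⟨2, [[.sqrtDelta]], []⟩, ⟨3, [], [[.sum 0 0], [.sum 1 2], [.sum 2 1]]⟩ ]

/-- The symbolic form of `Radicals.listC3S3Zeta`. -/
def symC3S3Zeta : List SymRow :=
  [ ⟨2, [[.sqrtDelta]], []⟩,
    ⟨3, [[.cbrt 0]], [[.rho 0], [.rho 1], [.rho 2]]⟩,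
    ⟨6, [[.sqrtDelta, .rho 0], [.sqrtDelta, .cbrt 0]], [[.alpha 0], [.beta 0]]⟩,
    ⟨9, [], [[.sum 0 0], [.sum 1 2], [.sum 2 1]]⟩ ]

/-! ### The conditions distinguishing the cases -/

/-- Whether all codes in `H` fix the generator `s`. -/
def allFix (H : ℕ) (s : Sym) : Bool := (bits H).all s.fixes

/-- Whether the codes in `H` act transitively on the six roots. -/
def transMask (H : ℕ) : Bool :=
  ((bits H).any fun g => sOf g == 1) &&
    (List.range 3).all fun i => (bits H).any fun g => sOf g == 0 && iOf g == i

/-- Whether some cube root of `b` is fixed. -/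
def cubeMask (H : ℕ) : Bool := (List.finRange 3).any fun k => allFix H (.cbrt k)

/-- Whether some root of `R` is fixed. -/
def rootMask (H : ℕ) : Bool := (List.finRange 3).any fun k => allFix H (.rho k)

/-- Fixing both a cube root of b and a root of R leaves a point stabilizer in each S₃ factor, hence
a group of order dividing 4. Transitivity on six roots requires order divisible by 3. -/
theorem rootMask_of_cubeMask : ∀ H ∈ subgroupMasks,
    transMask H = true → cubeMask H = true → rootMask H = false := by decide +kernel

/-- The symbol `.rho 0`, rather than an arbitrary root of R, has to be fixed: the listed sums depend
on the choice of α and β, and this records the condition α β (α + β) ∈ K. -/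
theorem completeFor_symD6NotCube : ∀ H ∈ subgroupMasks, transMask H = true →
    allFix H .zeta = false → allFix H .sqrtNegThreeDelta = false → cubeMask H = false →
    allFix H (.rho 0) = true → completeFor H symD6NotCube = true := by decide +kernel

theorem completeFor_symD6Cube : ∀ H ∈ subgroupMasks, transMask H = true →
    allFix H .zeta = false → allFix H .sqrtNegThreeDelta = false →
    allFix H (.cbrt 0) = true → completeFor H symD6Cube = true := by decide +kernel

theorem completeFor_symS3S3 : ∀ H ∈ subgroupMasks, transMask H = true →
    allFix H .zeta = false → allFix H .sqrtNegThreeDelta = false → cubeMask H = false →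
    rootMask H = false → completeFor H symS3S3 = true := by decide +kernel

theorem completeFor_symS3NoZeta : ∀ H ∈ subgroupMasks, transMask H = true →
    allFix H .zeta = false → allFix H .sqrtNegThreeDelta = true → cubeMask H = false →
    rootMask H = true → completeFor H symS3NoZeta = true := by decide +kernel

theorem completeFor_symC6NoZeta : ∀ H ∈ subgroupMasks, transMask H = true →
    allFix H .zeta = false → allFix H .sqrtNegThreeDelta = true →
    allFix H (.cbrt 0) = true → completeFor H symC6NoZeta = true := by decide +kernel

theorem completeFor_symC3S3NoZeta : ∀ H ∈ subgroupMasks, transMask H = true →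
    allFix H .zeta = false → allFix H .sqrtNegThreeDelta = true → cubeMask H = false →
    rootMask H = false → completeFor H symC3S3NoZeta = true := by decide +kernel

theorem completeFor_symC6Zeta : ∀ H ∈ subgroupMasks, transMask H = true →
    allFix H .zeta = true → cubeMask H = false → rootMask H = true →
    completeFor H symC6Zeta = true := by decide +kernel

theorem completeFor_symS3Zeta : ∀ H ∈ subgroupMasks, transMask H = true →
    allFix H .zeta = true → cubeMask H = true → completeFor H symS3Zeta = true := by
  decide +kernel

theorem completeFor_symC3S3Zeta : ∀ H ∈ subgroupMasks, transMask H = true →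
    allFix H .zeta = true → cubeMask H = false → rootMask H = false →
    completeFor H symC3S3Zeta = true := by decide +kernel

/-! ### Isomorphism types -/

/-- `e` encodes an isomorphism of `X` with the group of codes in `H`. -/
def IsoCode {X : Type*} [Mul X] (e : X → ℕ) (H : ℕ) : Prop :=
  (∀ x y, e (x * y) = mulCode (e x) (e y)) ∧ (∀ x y, e x = e y → x = y) ∧
    (∀ x, H.testBit (e x) = true) ∧ ∀ g < 36, H.testBit g = true → ∃ x, e x = g

instance {X : Type*} [Mul X] [Fintype X] [DecidableEq X] (e : X → ℕ) (H : ℕ) :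
    Decidable (IsoCode e H) :=
  inferInstanceAs (Decidable (_ ∧ _ ∧ _ ∧ _))

/-- Powers of a code. -/
def powCode (g : ℕ) : ℕ → ℕ
  | 0 => 0
  | n + 1 => mulCode g (powCode g n)

/-- The homomorphism from a cyclic group taking a generator to `g`. -/
def cyclicCode (n g : ℕ) (x : Multiplicative (ZMod n)) : ℕ := powCode g x.toAdd.val

/-- The homomorphism from a dihedral group taking `r 1` to `p` and `sr 0` to `q`. -/
def dihedralCode (n p q : ℕ) : DihedralGroup n → ℕ
  | .r i => powCode p i.val
  | .sr i => mulCode q (powCode p i.val)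

/-- The homomorphism from `S₃` taking the rotation to `c` and a reflection to `w`. -/
def permCode (c w : ℕ) (x : Equiv.Perm (Fin 3)) : ℕ :=
  -- A permutation of `Fin 3` is determined by the image of 0 and by its parity, and it is a
  -- rotation exactly when x 1 = x 0 + 1.
  mulCode (powCode c (x 0)) (if x 1 = x 0 + 1 then 0 else w)

instance (n g H : ℕ) [NeZero n] : Decidable (IsoCode (cyclicCode n g) H) :=
  inferInstanceAs (Decidable (_ ∧ _ ∧ _ ∧ _))

/-- Code 22 is α ↦ ζβ, β ↦ ζα with ζ fixed, of order 6; code 9 inverts ζ and fixes α and β. Both fix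
ρ₀. -/
theorem isoCode_symD6NotCube : ∀ H ∈ subgroupMasks, transMask H = true →
    allFix H .zeta = false → allFix H .sqrtNegThreeDelta = false → cubeMask H = false →
    allFix H (.rho 0) = true → IsoCode (dihedralCode 6 22 9) H := by decide +kernel

theorem isoCode_symD6Cube : ∀ H ∈ subgroupMasks, transMask H = true →
    allFix H .zeta = false → allFix H .sqrtNegThreeDelta = false →
    allFix H (.cbrt 0) = true → IsoCode (dihedralCode 6 32 9) H := by decide +kernel

/-- Codes 4 and 27 generate the S₃ that fixes all roots of R and permutes the cube roots of b; codes
5 and 18 generate the S₃ that does the reverse. These are the two direct factors. -/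
theorem isoCode_symS3S3 : ∀ H ∈ subgroupMasks, transMask H = true →
    allFix H .zeta = false → allFix H .sqrtNegThreeDelta = false → cubeMask H = false →
    rootMask H = false →
    IsoCode (fun x : Equiv.Perm (Fin 3) × Equiv.Perm (Fin 3) =>
      mulCode (permCode 4 27 x.1) (permCode 5 18 x.2)) H := by decide +kernel

theorem isoCode_symS3NoZeta : ∀ H ∈ subgroupMasks, transMask H = true →
    allFix H .zeta = false → allFix H .sqrtNegThreeDelta = true → cubeMask H = false →
    rootMask H = true → ∃ w ∈ List.range 36, IsoCode (permCode 4 w) H := by decide +kernel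

theorem isoCode_symC6NoZeta : ∀ H ∈ subgroupMasks, transMask H = true →
    allFix H .zeta = false → allFix H .sqrtNegThreeDelta = true →
    allFix H (.cbrt 0) = true → IsoCode (cyclicCode 6 32) H := by decide +kernel

theorem isoCode_symC3S3NoZeta : ∀ H ∈ subgroupMasks, transMask H = true →
    allFix H .zeta = false → allFix H .sqrtNegThreeDelta = true → cubeMask H = false →
    rootMask H = false →
    IsoCode (fun x : Multiplicative (ZMod 3) × Equiv.Perm (Fin 3) =>
      mulCode (cyclicCode 3 5 x.1) (permCode 4 27 x.2)) H := by decide +kernel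

/-- The mask depends on which root of R is fixed, so no single generator serves for all H. -/
theorem isoCode_symC6Zeta : ∀ H ∈ subgroupMasks, transMask H = true →
    allFix H .zeta = true → cubeMask H = false → rootMask H = true →
    ∃ g ∈ List.range 36, IsoCode (cyclicCode 6 g) H := by decide +kernel

theorem isoCode_symS3Zeta : ∀ H ∈ subgroupMasks, transMask H = true →
    allFix H .zeta = true → cubeMask H = true →
    ∃ w ∈ List.range 36, IsoCode (permCode 5 w) H := by decide +kernel

theorem isoCode_symC3S3Zeta : ∀ H ∈ subgroupMasks, transMask H = true →
    allFix H .zeta = true → cubeMask H = false → rootMask H = false →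
    IsoCode (fun x : Multiplicative (ZMod 3) × Equiv.Perm (Fin 3) =>
      mulCode (cyclicCode 3 4 x.1) (permCode 5 18 x.2)) H := by decide +kernel

/-! ### Existence of the radicals and identities among them -/

variable {K : Type u} {F : Type v} [Field K] [Field F] [Algebra K F] {a b : K}

theorem one_add_zeta {z : F} (hz : IsPrimitiveRoot z 3) : 1 + z + z ^ 2 = 0 := by
  have h1 : z - 1 ≠ 0 := sub_ne_zero.2 (hz.ne_one (by norm_num))
  have h3 := hz.pow_eq_one
  exact (mul_eq_zero.1 (by linear_combination h3 : (z - 1) * (1 + z + z ^ 2) = 0)).resolve_left h1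

theorem exists_pow_mul_of_cube_eq {z x y : F} (hz : IsPrimitiveRoot z 3) (h : x ^ 3 = y ^ 3) :
    ∃ i < 3, x = z ^ i * y := by
  have h1 := one_add_zeta hz
  have h3 := hz.pow_eq_one
  have : (x - y) * ((x - z * y) * (x - z ^ 2 * y)) = 0 := by
    linear_combination h + (-x ^ 2 * y + x * y ^ 2 * z) * h1 - y ^ 3 * h3
  rcases mul_eq_zero.1 this with h | h
  · exact ⟨0, by norm_num, by linear_combination h⟩
  rcases mul_eq_zero.1 h with h | h
  · exact ⟨1, by norm_num, by linear_combination h⟩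
  · exact ⟨2, by norm_num, by linear_combination h⟩

theorem sextic_monic : (sextic a b).Monic := by
  unfold sextic; monicity!

theorem sextic_natDegree : (sextic a b).natDegree = 6 := by
  unfold sextic; compute_degree!

theorem aeval_sextic (x : F) :
    aeval x (sextic a b) = x ^ 6 + algebraMap K F a * x ^ 3 + algebraMap K F b := by
  simp [sextic]

theorem minpoly_eq_sextic (hf : Irreducible (sextic a b)) {x : F}
    (hx : aeval x (sextic a b) = 0) : minpoly K x = sextic a b :=
  (minpoly.eq_of_irreducible_of_monic hf hx sextic_monic).symm

/-- Otherwise x would be a root of a cubic over K, although its minimal polynomial has degree 6. -/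
theorem cube_notMem_range (hf : Irreducible (sextic a b)) {x : F}
    (hx : aeval x (sextic a b) = 0) : x ^ 3 ∉ (algebraMap K F).range := by
  rintro ⟨k, hk⟩
  have h := minpoly.dvd K x (p := X ^ 3 - C k) (by simp [hk])
  rw [minpoly_eq_sextic hf hx] at h
  have h' := natDegree_le_of_dvd h (X_pow_sub_C_ne_zero (by norm_num) k)
  rw [natDegree_X_pow_sub_C, sextic_natDegree] at h'
  omega

theorem sextic_separable (h2 : (2 : K) ≠ 0) (h3 : (3 : K) ≠ 0) (hf : Irreducible (sextic a b)) :
    (sextic a b).Separable := by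
  rw [separable_iff_derivative_ne_zero hf]
  intro h
  have h6 : (sextic a b).coeff 6 = 1 := by
    simpa [Monic, leadingCoeff, sextic_natDegree] using sextic_monic (a := a) (b := b)
  have h5 := congrArg (fun p => p.coeff 5) h
  -- The coefficient of x⁵ in the derivative is 6 = 2 · 3, nonzero by the two hypotheses on the
  -- characteristic.
  simp only [coeff_derivative, coeff_zero, Nat.reduceAdd, h6] at h5
  exact mul_ne_zero h2 h3 (by push_cast at h5; linear_combination h5)

theorem isPrimitiveRoot_three {z : F} (h3 : (3 : F) ≠ 0) (h : 1 + z + z ^ 2 = 0) :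
    IsPrimitiveRoot z 3 := by
  rw [IsPrimitiveRoot.iff_orderOf]
  refine orderOf_eq_prime (by linear_combination (z - 1) * h) ?_
  rintro rfl
  exact h3 (by linear_combination h)

/-- Over F the sextic is (x³ - α³)(x³ + a + α³) for any root α. The second factor supplies β, the
quadratic cofactor of x - α in the first supplies αζ, and the square roots are polynomials in α³ and
ζ. -/
theorem nonempty_radicals (h2 : (2 : K) ≠ 0) (h3 : (3 : K) ≠ 0)
    (hf : Irreducible (sextic a b)) (hF : (sextic a b).IsSplittingField K F) :
    Nonempty (Radicals F a b) := by
  have h2' : (2 : F) ≠ 0 := by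
    rw [← map_ofNat (algebraMap K F) 2]; exact (_root_.map_ne_zero _).2 h2
  have h3' : (3 : F) ≠ 0 := by
    rw [← map_ofNat (algebraMap K F) 3]; exact (_root_.map_ne_zero _).2 h3
  have hs := hF.splits
  obtain ⟨α, hα⟩ := hs.exists_eval_eq_zero (by
    rw [degree_map]; exact (degree_pos_of_irreducible hf).ne')
  rw [eval_map_algebraMap] at hα
  have hα3 := cube_notMem_range hf hα
  rw [aeval_sextic] at hα
  have hfac : (sextic a b).map (algebraMap K F) =
      (X ^ 3 - C (α ^ 3)) * (X ^ 3 - C (-algebraMap K F a - α ^ 3)) := by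
    have h : C (algebraMap K F b) = C (-(α ^ 6 + algebraMap K F a * α ^ 3)) := by
      congr 1; linear_combination hα
    simp only [sextic, Polynomial.map_add, Polynomial.map_mul, Polynomial.map_pow, map_X, map_C, h]
    simp only [map_sub, map_neg, map_add, map_mul, map_pow]
    ring
  have hne : (sextic a b).map (algebraMap K F) ≠ 0 := (sextic_monic.map _).ne_zero
  have hα0 : α ≠ 0 := fun h => hα3 ⟨0, by simp [h]⟩
  obtain ⟨β, hβ⟩ := (hs.of_dvd hne (hfac ▸ dvd_mul_left _ _)).exists_eval_eq_zero (by
    rw [degree_X_pow_sub_C (by norm_num)]; norm_num)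
  obtain ⟨y, hy⟩ := (hs.of_dvd (f := X ^ 2 + C α * X + C (α ^ 2)) hne
    (hfac ▸ Dvd.dvd.mul_right ⟨X - C α, by simp only [map_pow]; ring⟩ _)).exists_eval_eq_zero (by
      have : (X ^ 2 + C α * X + C (α ^ 2)).degree = 2 := by compute_degree!
      rw [this]; norm_num)
  simp only [eval_sub, eval_add, eval_mul, eval_pow, eval_X, eval_C] at hβ hy
  have hz : 1 + y / α + (y / α) ^ 2 = 0 := by field_simp; linear_combination hy
  have hΔ : (2 * α ^ 3 + algebraMap K F a) ^ 2 = algebraMap K F (a ^ 2 - 4 * b) := by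
    simp only [map_sub, map_pow, map_mul, map_ofNat]; linear_combination 4 * hα
  have h3s : (1 + 2 * (y / α)) ^ 2 = -3 := by linear_combination 4 * hz
  refine ⟨⟨y / α, 2 * α ^ 3 + algebraMap K F a, 1 + 2 * (y / α),
    (1 + 2 * (y / α)) * (2 * α ^ 3 + algebraMap K F a), α, β,
    isPrimitiveRoot_three h3' hz, hΔ, h3s, ?_, ?_, ?_⟩⟩
  · rw [mul_pow, h3s, hΔ]; simp only [map_mul, map_neg, map_ofNat]
  · field_simp; ring
  · field_simp; linear_combination 2 * hβ

namespace Radicals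

/-- The hypotheses on a choice of radicals used in computations: the characteristic is not `2`
or `3`, and `α ^ 3` does not lie in `K`. -/
structure Regular (r : Radicals F a b) : Prop where
  two_ne : (2 : F) ≠ 0
  three_ne : (3 : F) ≠ 0
  α_cube_notMem : r.α ^ 3 ∉ (algebraMap K F).range

variable {r : Radicals F a b}

theorem zeta_pow (r : Radicals F a b) : r.ζ ^ 3 = 1 := r.isPrimitiveRoot_ζ.pow_eq_one

theorem zeta_sum (r : Radicals F a b) : 1 + r.ζ + r.ζ ^ 2 = 0 := one_add_zeta r.isPrimitiveRoot_ζ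

theorem zeta_pow_mod (r : Radicals F a b) (n : ℕ) : r.ζ ^ (n % 3) = r.ζ ^ n :=
  (pow_eq_pow_mod n r.zeta_pow).symm

theorem zeta_pow_inj (r : Radicals F a b) {m n : ℕ} :
    r.ζ ^ m = r.ζ ^ n ↔ m % 3 = n % 3 := by
  rw [← r.zeta_pow_mod m, ← r.zeta_pow_mod n]
  exact ⟨r.isPrimitiveRoot_ζ.pow_inj (Nat.mod_lt _ (by norm_num)) (Nat.mod_lt _ (by norm_num)),
    fun h => by rw [h]⟩

namespace Regular

theorem α_ne (hr : r.Regular) : r.α ≠ 0 := fun h => hr.α_cube_notMem ⟨0, by simp [h]⟩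

theorem cube_add (hr : r.Regular) : r.α ^ 3 + r.β ^ 3 = -algebraMap K F a := by
  have := hr.two_ne
  rw [r.α_cube, r.β_cube]; field_simp; ring

theorem cube_sub (hr : r.Regular) : r.α ^ 3 - r.β ^ 3 = r.sqrtDelta := by
  have := hr.two_ne
  rw [r.α_cube, r.β_cube]; field_simp; ring

theorem β_cube_notMem (hr : r.Regular) : r.β ^ 3 ∉ (algebraMap K F).range := by
  rintro ⟨k, hk⟩
  exact hr.α_cube_notMem ⟨-a - k, by rw [map_sub, map_neg, hk]; linear_combination -hr.cube_add⟩

theorem β_ne (hr : r.Regular) : r.β ≠ 0 := fun h => hr.β_cube_notMem ⟨0, by simp [h]⟩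

theorem sqrtDelta_notMem (hr : r.Regular) : r.sqrtDelta ∉ (algebraMap K F).range := by
  have := hr.two_ne
  rintro ⟨k, hk⟩
  exact hr.α_cube_notMem ⟨(-a + k) / 2, by
    rw [r.α_cube, ← hk]; simp only [map_div₀, map_add, map_neg, map_ofNat]⟩

theorem sqrtDelta_ne (hr : r.Regular) : r.sqrtDelta ≠ 0 :=
  fun h => hr.sqrtDelta_notMem ⟨0, by simp [h]⟩

theorem α_cube_ne (hr : r.Regular) : r.α ^ 3 ≠ r.β ^ 3 :=
  fun h => hr.sqrtDelta_ne (by rw [← hr.cube_sub, h, sub_self])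

theorem cbrt_cube (hr : r.Regular) : r.cbrt ^ 3 = algebraMap K F b := by
  have h4 : (4 : F) ≠ 0 := by
    have := mul_ne_zero hr.two_ne hr.two_ne
    norm_num at this ⊢; exact this
  have hΔ := r.sqrtDelta_sq
  simp only [map_sub, map_pow, map_mul, map_ofNat] at hΔ
  have := hr.two_ne
  rw [cbrt, mul_pow, r.α_cube, r.β_cube]
  field_simp
  linear_combination -hΔ

theorem cbrt_ne (hr : r.Regular) : r.cbrt ≠ 0 := mul_ne_zero hr.α_ne hr.β_ne

theorem aeval_α (hr : r.Regular) : aeval r.α (sextic a b) = 0 := by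
  have h := hr.cbrt_cube
  rw [cbrt] at h
  rw [aeval_sextic]
  linear_combination r.α ^ 3 * hr.cube_add - h

theorem aeval_sextic_eq (hr : r.Regular) (x : F) :
    aeval x (sextic a b) = (x ^ 3 - r.α ^ 3) * (x ^ 3 - r.β ^ 3) := by
  have h := hr.cbrt_cube
  rw [cbrt] at h
  rw [aeval_sextic]
  linear_combination -h + x ^ 3 * hr.cube_add

end Regular

theorem regular (h2 : (2 : K) ≠ 0) (h3 : (3 : K) ≠ 0) (hf : Irreducible (sextic a b))
    (r : Radicals F a b) : r.Regular := by
  have h2' : (2 : F) ≠ 0 := by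
    rw [← map_ofNat (algebraMap K F) 2]; exact (_root_.map_ne_zero _).2 h2
  have h3' : (3 : F) ≠ 0 := by
    rw [← map_ofNat (algebraMap K F) 3]; exact (_root_.map_ne_zero _).2 h3
  refine ⟨h2', h3', cube_notMem_range hf ?_⟩
  have hΔ := r.sqrtDelta_sq
  simp only [map_sub, map_pow, map_mul, map_ofNat] at hΔ
  have h4 : (4 : F) ≠ 0 := by
    have := mul_ne_zero h2' h2'
    norm_num at this ⊢; exact this
  rw [aeval_sextic, show r.α ^ 6 = (r.α ^ 3) ^ 2 by ring, r.α_cube]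
  field_simp
  linear_combination hΔ

end Radicals

/-! ### Components of codes -/

theorem sOf_mkCode {s t i j : ℕ} (ht : t < 2) (hi : i < 3) (hj : j < 3) :
    sOf (mkCode s t i j) = s := by unfold sOf mkCode; omega

theorem tOf_mkCode {s t i j : ℕ} (ht : t < 2) (hi : i < 3) (hj : j < 3) :
    tOf (mkCode s t i j) = t := by unfold tOf mkCode; omega

theorem iOf_mkCode {s t i j : ℕ} (hi : i < 3) (hj : j < 3) :
    iOf (mkCode s t i j) = i := by unfold iOf mkCode; omega

theorem jOf_mkCode {s t i j : ℕ} (hj : j < 3) :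
    jOf (mkCode s t i j) = j := by unfold jOf mkCode; omega

theorem mkCode_lt {s t i j : ℕ} (hs : s < 2) (ht : t < 2) (hi : i < 3) (hj : j < 3) :
    mkCode s t i j < 36 := by unfold mkCode; omega

theorem mkCode_of (g : ℕ) : mkCode (sOf g) (tOf g) (iOf g) (jOf g) = g := by
  unfold mkCode sOf tOf iOf jOf; omega

theorem tOf_lt (g : ℕ) : tOf g < 2 := Nat.mod_lt _ (by norm_num)

theorem iOf_lt (g : ℕ) : iOf g < 3 := Nat.mod_lt _ (by norm_num)

theorem jOf_lt (g : ℕ) : jOf g < 3 := Nat.mod_lt _ (by norm_num)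

theorem sOf_lt {g : ℕ} (h : g < 36) : sOf g < 2 := by unfold sOf; omega

/-! ### Automorphisms and their codes -/

namespace Radicals

/-- The automorphism `σ` has the code `g`. -/
structure Acts (r : Radicals F a b) (σ : Gal(F/K)) (g : ℕ) : Prop where
  lt : g < 36
  zeta : σ r.ζ = r.ζ ^ (1 + tOf g)
  alpha : σ r.α = r.ζ ^ iOf g * if sOf g = 0 then r.α else r.β
  beta : σ r.β = r.ζ ^ jOf g * if sOf g = 0 then r.β else r.α

variable {r : Radicals F a b}

/-- The sign of σ on √Δ decides whether α³ and β³ are kept or exchanged; cube roots of a given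
number differ by powers of ζ. -/
theorem exists_acts (r : Radicals F a b) (σ : Gal(F/K)) : ∃ g, r.Acts σ g := by
  have hζ : ∃ t < 2, σ r.ζ = r.ζ ^ (1 + t) := by
    have h1 := congrArg σ r.zeta_sum
    simp only [map_add, map_one, map_pow, map_zero] at h1
    have h2 : (σ r.ζ - r.ζ) * (σ r.ζ - r.ζ ^ 2) = 0 := by
      linear_combination h1 - (1 + σ r.ζ) * r.zeta_sum + r.zeta_pow + r.zeta_sum
    rcases mul_eq_zero.1 h2 with h | h
    · exact ⟨0, by norm_num, by linear_combination h⟩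
    · exact ⟨1, by norm_num, by linear_combination h⟩
  obtain ⟨t, ht, htζ⟩ := hζ
  have hα := congrArg σ r.α_cube
  have hβ := congrArg σ r.β_cube
  simp only [map_pow, map_div₀, map_add, map_sub, map_neg, AlgEquiv.commutes, map_ofNat] at hα hβ
  have hΔ := congrArg σ r.sqrtDelta_sq
  rw [map_pow, AlgEquiv.commutes, ← r.sqrtDelta_sq, sq_eq_sq_iff_eq_or_eq_neg] at hΔ
  rcases hΔ with h | h <;> rw [h] at hα hβ
  · rw [← r.α_cube] at hα
    rw [← r.β_cube] at hβ
    obtain ⟨i, hi, hiα⟩ := exists_pow_mul_of_cube_eq r.isPrimitiveRoot_ζ hα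
    obtain ⟨j, hj, hjβ⟩ := exists_pow_mul_of_cube_eq r.isPrimitiveRoot_ζ hβ
    refine ⟨mkCode 0 t i j, mkCode_lt (by norm_num) ht hi hj, ?_, ?_, ?_⟩
    · rw [tOf_mkCode ht hi hj, htζ]
    · rw [iOf_mkCode hi hj, sOf_mkCode ht hi hj, if_pos rfl, hiα]
    · rw [jOf_mkCode hj, sOf_mkCode ht hi hj, if_pos rfl, hjβ]
  · rw [← sub_eq_add_neg, ← r.β_cube] at hα
    rw [sub_neg_eq_add, ← r.α_cube] at hβ
    obtain ⟨i, hi, hiα⟩ := exists_pow_mul_of_cube_eq r.isPrimitiveRoot_ζ hα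
    obtain ⟨j, hj, hjβ⟩ := exists_pow_mul_of_cube_eq r.isPrimitiveRoot_ζ hβ
    refine ⟨mkCode 1 t i j, mkCode_lt (by norm_num) ht hi hj, ?_, ?_, ?_⟩
    · rw [tOf_mkCode ht hi hj, htζ]
    · rw [iOf_mkCode hi hj, sOf_mkCode ht hi hj, if_neg one_ne_zero, hiα]
    · rw [jOf_mkCode hj, sOf_mkCode ht hi hj, if_neg one_ne_zero, hjβ]

namespace Acts

variable {σ τ : Gal(F/K)} {g h : ℕ}

theorem map_zeta_pow (hσ : r.Acts σ g) (n : ℕ) : σ (r.ζ ^ n) = r.ζ ^ ((1 + tOf g) * n) := by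
  rw [map_pow, hσ.zeta, pow_mul]

theorem mul (hσ : r.Acts σ g) (hτ : r.Acts τ h) : r.Acts (σ * τ) (mulCode g h) := by
  have h3 : ∀ n, n % 3 < 3 := fun n => Nat.mod_lt _ (by norm_num)
  have h2 : ∀ n, n % 2 < 2 := fun n => Nat.mod_lt _ (by norm_num)
  have hs := sOf_lt hσ.lt
  have hs' := sOf_lt hτ.lt
  unfold mulCode
  refine ⟨mkCode_lt (h2 _) (h2 _) (h3 _) (h3 _), ?_, ?_, ?_⟩
  · rw [tOf_mkCode (h2 _) (h3 _) (h3 _), AlgEquiv.mul_apply, hτ.zeta, hσ.map_zeta_pow,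
      zeta_pow_inj]
    have := tOf_lt g
    have := tOf_lt h
    interval_cases tOf g <;> interval_cases tOf h <;> rfl
  · rw [iOf_mkCode (h3 _) (h3 _), sOf_mkCode (h2 _) (h3 _) (h3 _), AlgEquiv.mul_apply, hτ.alpha,
      map_mul, hσ.map_zeta_pow, zeta_pow_mod, pow_add, mul_assoc]
    congr 1
    interval_cases h1 : sOf g <;> interval_cases h1' : sOf h <;>
      simp [hσ.alpha, hσ.beta, h1]
  · rw [jOf_mkCode (h3 _), sOf_mkCode (h2 _) (h3 _) (h3 _), AlgEquiv.mul_apply, hτ.beta,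
      map_mul, hσ.map_zeta_pow, zeta_pow_mod, pow_add, mul_assoc]
    congr 1
    interval_cases h1 : sOf g <;> interval_cases h1' : sOf h <;>
      simp [hσ.alpha, hσ.beta, h1]

theorem one (r : Radicals F a b) : r.Acts (1 : Gal(F/K)) 0 :=
  ⟨by norm_num, by simp [tOf], by simp [iOf, sOf], by simp [jOf, sOf]⟩

theorem map_sqrtDelta (hr : r.Regular) (hσ : r.Acts σ g) :
    σ r.sqrtDelta = if sOf g = 0 then r.sqrtDelta else -r.sqrtDelta := by
  rw [← hr.cube_sub, map_sub, map_pow, map_pow, hσ.alpha, hσ.beta]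
  simp only [mul_pow, ← pow_mul, mul_comm _ 3, pow_mul _ 3, r.zeta_pow, one_pow, one_mul]
  split_ifs <;> ring

theorem map_cbrt (hσ : r.Acts σ g) : σ r.cbrt = r.ζ ^ (iOf g + jOf g) * r.cbrt := by
  rw [cbrt, map_mul, hσ.alpha, hσ.beta]
  split_ifs <;> ring

/-- Each component can be read off: s from the sign on √Δ ≠ 0, then t, i, j from the images of ζ, α,
β. This works for a = 0 as well, since α³ ≠ β³ always. -/
theorem code_unique (hr : r.Regular) (hσ : r.Acts σ g) (hσ' : r.Acts σ h) : g = h := by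
  have hs : sOf g = sOf h := by
    have h1 := hσ.map_sqrtDelta hr
    rw [hσ'.map_sqrtDelta hr] at h1
    have hne : -r.sqrtDelta ≠ r.sqrtDelta := fun h => hr.sqrtDelta_ne (by
      have : 2 * r.sqrtDelta = 0 := by linear_combination -h
      exact (mul_eq_zero.1 this).resolve_left hr.two_ne)
    have := sOf_lt hσ.lt
    have := sOf_lt hσ'.lt
    split_ifs at h1
    · omega
    · exact absurd h1 hne.symm
    · exact absurd h1 hne
    · omega
  have ht : tOf g = tOf h := by
    have h1 := hσ.zeta.symm.trans hσ'.zeta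
    rw [zeta_pow_inj] at h1
    have := tOf_lt g
    have := tOf_lt h
    omega
  have hpick : ∀ s, (if s = 0 then r.α else r.β) ≠ 0 := fun s => by
    split_ifs; exacts [hr.α_ne, hr.β_ne]
  have hpick' : ∀ s, (if s = 0 then r.β else r.α) ≠ 0 := fun s => by
    split_ifs; exacts [hr.β_ne, hr.α_ne]
  have hi : iOf g = iOf h := by
    have h1 := hσ.alpha.symm.trans hσ'.alpha
    rw [hs] at h1
    have h1 := mul_right_cancel₀ (hpick _) h1
    rw [zeta_pow_inj] at h1
    have := iOf_lt g
    have := iOf_lt h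
    omega
  have hj : jOf g = jOf h := by
    have h1 := hσ.beta.symm.trans hσ'.beta
    rw [hs] at h1
    have h1 := mul_right_cancel₀ (hpick' _) h1
    rw [zeta_pow_inj] at h1
    have := jOf_lt g
    have := jOf_lt h
    omega
  rw [← mkCode_of g, ← mkCode_of h, hs, ht, hi, hj]

theorem unique (hr : r.Regular) (hF : (sextic a b).IsSplittingField K F)
    (hσ : r.Acts σ g) (hτ : r.Acts τ g) : σ = τ := by
  have hζ : σ r.ζ = τ r.ζ := hσ.zeta.trans hτ.zeta.symm
  have hα : σ r.α = τ r.α := hσ.alpha.trans hτ.alpha.symm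
  have hβ : σ r.β = τ r.β := hσ.beta.trans hτ.beta.symm
  have hroot : ∀ x ∈ (sextic a b).rootSet F, σ x = τ x := by
    intro x hx
    have h0 := aeval_eq_zero_of_mem_rootSet hx
    rw [hr.aeval_sextic_eq] at h0
    rcases mul_eq_zero.1 h0 with h | h <;>
    · obtain ⟨i, -, rfl⟩ := exists_pow_mul_of_cube_eq r.isPrimitiveRoot_ζ (sub_eq_zero.1 h)
      simp [hζ, hα, hβ]
  have : (σ : F →ₐ[K] F) = τ := AlgHom.ext_of_adjoin_eq_top hF.adjoin_rootSet hroot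
  ext x
  exact DFunLike.congr_fun this x

end Acts

variable {σ : Gal(F/K)} {g : ℕ}

/-! ### Sums and differences of the cube roots -/

/-- The sum `α ζ ^ u + β ζ ^ v`. -/
def sum (r : Radicals F a b) (u v : ℕ) : F := r.α * r.ζ ^ u + r.β * r.ζ ^ v

/-- The difference `α ζ ^ u - β ζ ^ v`. -/
def sub (r : Radicals F a b) (u v : ℕ) : F := r.α * r.ζ ^ u - r.β * r.ζ ^ v

theorem sum_mod (r : Radicals F a b) (u v : ℕ) : r.sum (u % 3) (v % 3) = r.sum u v := by
  simp [sum, zeta_pow_mod]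

theorem zeta_pow_mul_sum (r : Radicals F a b) (d u v : ℕ) :
    r.ζ ^ d * r.sum u v = r.sum (d + u) (d + v) := by
  simp only [sum, pow_add]; ring

theorem zeta_pow_mul_sub (r : Radicals F a b) (d u v : ℕ) :
    r.ζ ^ d * r.sub u v = r.sub (d + u) (d + v) := by
  simp only [sub, pow_add]; ring

theorem Acts.map_sum (hσ : r.Acts σ g) (u v : ℕ) :
    σ (r.sum u v) = if sOf g = 0 then r.sum (iOf g + (1 + tOf g) * u) (jOf g + (1 + tOf g) * v)
      else r.sum (jOf g + (1 + tOf g) * v) (iOf g + (1 + tOf g) * u) := by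
  simp only [sum, map_add, map_mul, hσ.alpha, hσ.beta, hσ.map_zeta_pow]
  split_ifs <;> ring

theorem Acts.map_sub (hσ : r.Acts σ g) (u v : ℕ) :
    σ (r.sub u v) = if sOf g = 0 then r.sub (iOf g + (1 + tOf g) * u) (jOf g + (1 + tOf g) * v)
      else -r.sub (jOf g + (1 + tOf g) * v) (iOf g + (1 + tOf g) * u) := by
  simp only [sub, _root_.map_sub, map_mul, hσ.alpha, hσ.beta, hσ.map_zeta_pow]
  split_ifs <;> ring

theorem Regular.cube_ne_neg (hr : r.Regular) (ha : a ≠ 0) : r.α ^ 3 ≠ -r.β ^ 3 := by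
  intro h
  have := hr.cube_add
  rw [h, neg_add_cancel, eq_comm, neg_eq_zero, map_eq_zero] at this
  exact ha this

/-- The cube of a difference of two powers of `ζ` is `0` or `± 3 (ζ - ζ ^ 2)`. -/
theorem cube_zeta_pow_sub (r : Radicals F a b) (u v : ℕ) :
    (r.ζ ^ u - r.ζ ^ v) ^ 3 = if u % 3 = v % 3 then 0 else
      if (u + 1) % 3 = v % 3 then -(3 * (r.ζ - r.ζ ^ 2)) else 3 * (r.ζ - r.ζ ^ 2) := by
  rw [← r.zeta_pow_mod u, ← r.zeta_pow_mod v, show (u + 1) % 3 = (u % 3 + 1) % 3 by omega]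
  have hu : u % 3 < 3 := Nat.mod_lt _ (by norm_num)
  have hv : v % 3 < 3 := Nat.mod_lt _ (by norm_num)
  have h3 := r.zeta_pow
  have h1 := r.zeta_sum
  interval_cases u % 3 <;> interval_cases v % 3 <;> norm_num
  · linear_combination -h3
  · linear_combination (-r.ζ ^ 3 - 1 + 3 * r.ζ) * h3
  · linear_combination h3
  · linear_combination (3 * r.ζ ^ 2 - 3 * r.ζ - r.ζ ^ 3) * h3
  · linear_combination (r.ζ ^ 3 + 1 - 3 * r.ζ) * h3
  · linear_combination (-3 * r.ζ ^ 2 + 3 * r.ζ + r.ζ ^ 3) * h3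

theorem Regular.zeta_sub_ne (hr : r.Regular) : 3 * (r.ζ - r.ζ ^ 2) ≠ 0 := by
  refine mul_ne_zero hr.three_ne fun h => ?_
  have : r.ζ ^ 1 = r.ζ ^ 2 := by linear_combination h
  rw [zeta_pow_inj] at this
  norm_num at this

/-- An equality of sums reads α(ζ^u - ζ^u') = β(ζ^v' - ζ^v). Cubing leaves only the factors 0 and
±3(ζ - ζ²), so a nontrivial coincidence would force α³ = ±β³ or the vanishing of α or β. -/
theorem Regular.sum_inj (hr : r.Regular) (ha : a ≠ 0) {u v u' v' : ℕ} :
    r.sum u v = r.sum u' v' ↔ u % 3 = u' % 3 ∧ v % 3 = v' % 3 := by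
  constructor
  · intro h
    have h1 : r.α * (r.ζ ^ u - r.ζ ^ u') = r.β * (r.ζ ^ v' - r.ζ ^ v) := by
      simp only [sum] at h; linear_combination h
    have h3 := congrArg (· ^ 3) h1
    simp only [mul_pow, cube_zeta_pow_sub] at h3
    have hw := hr.zeta_sub_ne
    by_cases hu : u % 3 = u' % 3
    · refine ⟨hu, ?_⟩
      rw [(zeta_pow_inj r).2 hu, sub_self, mul_zero, eq_comm, mul_eq_zero, sub_eq_zero,
        zeta_pow_inj] at h1
      exact (h1.resolve_left hr.β_ne).symm
    · exfalso
      have hα := pow_ne_zero 3 hr.α_ne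
      have hne := hr.cube_ne_neg ha
      have hne' := hr.α_cube_ne
      rw [if_neg hu] at h3
      split_ifs at h3
      · exact mul_ne_zero hα (neg_ne_zero.2 hw) (by rw [h3, mul_zero])
      · exact hne' (mul_right_cancel₀ (neg_ne_zero.2 hw) h3)
      · exact hne (mul_right_cancel₀ hw (by linear_combination -h3))
      · exact mul_ne_zero hα hw (by rw [h3, mul_zero])
      · exact hne (mul_right_cancel₀ hw (by linear_combination h3))
      · exact hne' (mul_right_cancel₀ hw h3)
  · rintro ⟨hu, hv⟩
    rw [← sum_mod, hu, hv, sum_mod]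

/-- The generator denoted by a symbol. -/
def eval (r : Radicals F a b) : Sym → F
  | .sqrtDelta => r.sqrtDelta
  | .zeta => r.ζ
  | .sqrtNegThree => r.sqrtNegThree
  | .sqrtNegThreeDelta => r.sqrtNegThreeDelta
  | .cbrt k => match k with
    | 0 => r.cbrt | 1 => r.cbrt * r.ζ | 2 => r.cbrt * r.ζ ^ 2
  | .rho k => match k with
    | 0 => r.cbrt * (r.α + r.β)
    | 1 => r.cbrt * (r.α * r.ζ + r.β * r.ζ ^ 2)
    | 2 => r.cbrt * (r.α * r.ζ ^ 2 + r.β * r.ζ)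
  | .alpha k => match k with
    | 0 => r.α | 1 => r.α * r.ζ | 2 => r.α * r.ζ ^ 2
  | .beta k => match k with
    | 0 => r.β | 1 => r.β * r.ζ | 2 => r.β * r.ζ ^ 2
  | .sum u v => match u, v with
    | 0, 0 => r.α + r.β
    | 0, 1 => r.α + r.β * r.ζ
    | 0, 2 => r.α + r.β * r.ζ ^ 2
    | 1, 0 => r.α * r.ζ + r.β
    | 1, 1 => (r.α + r.β) * r.ζ
    | 1, 2 => r.α * r.ζ + r.β * r.ζ ^ 2
    | 2, 0 => r.α * r.ζ ^ 2 + r.β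
    | 2, 1 => r.α * r.ζ ^ 2 + r.β * r.ζ
    | 2, 2 => (r.α + r.β) * r.ζ ^ 2
  | .diff k => match k with
    | 0 => (r.ζ - 1) * (r.α - r.β)
    | 1 => r.ζ * (r.ζ - 1) * (r.α - r.β)
    | 2 => r.ζ ^ 2 * (r.ζ - 1) * (r.α - r.β)

theorem eval_cbrt (r : Radicals F a b) (k : Fin 3) :
    r.eval (.cbrt k) = r.cbrt * r.ζ ^ (k : ℕ) := by
  fin_cases k <;> simp [eval]

theorem eval_alpha (r : Radicals F a b) (k : Fin 3) :
    r.eval (.alpha k) = r.α * r.ζ ^ (k : ℕ) := by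
  fin_cases k <;> simp [eval]

theorem eval_beta (r : Radicals F a b) (k : Fin 3) :
    r.eval (.beta k) = r.β * r.ζ ^ (k : ℕ) := by
  fin_cases k <;> simp [eval]

theorem eval_sum (r : Radicals F a b) (u v : Fin 3) : r.eval (.sum u v) = r.sum u v := by
  fin_cases u <;> fin_cases v <;> simp [eval, sum] <;> ring

theorem eval_rho (r : Radicals F a b) (k : Fin 3) :
    r.eval (.rho k) = r.cbrt * r.sum k (2 * k) := by
  have := r.zeta_pow
  fin_cases k
  · simp [eval, sum]
  · simp [eval, sum]
  · simp only [eval, sum]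
    linear_combination -r.cbrt * r.β * r.ζ * this

theorem eval_diff (r : Radicals F a b) (k : Fin 3) :
    r.eval (.diff k) = (r.ζ - 1) * r.sub k k := by
  fin_cases k <;> simp [eval, sub] <;> ring

/-! ### Fixed generators, actual and formal -/

/-- The generator denoted by `s` is fixed by exactly those automorphisms whose codes are
said to fix it. -/
def FixOK (r : Radicals F a b) (s : Sym) : Prop :=
  ∀ (σ : Gal(F/K)) (g : ℕ), r.Acts σ g → (σ (r.eval s) = r.eval s ↔ s.fixes g = true)

theorem Regular.neg_eq_self (hr : r.Regular) {x : F} (hx : x ≠ 0) : -x ≠ x := fun h => by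
  have : 2 * x = 0 := by linear_combination -h
  exact hx ((mul_eq_zero.1 this).resolve_left hr.two_ne)

theorem sqrtNegThree_eq (r : Radicals F a b) :
    r.sqrtNegThree = 1 + 2 * r.ζ ∨ r.sqrtNegThree = -(1 + 2 * r.ζ) := by
  rw [← sq_eq_sq_iff_eq_or_eq_neg, r.sqrtNegThree_sq]
  linear_combination -4 * r.zeta_sum

theorem sqrtNegThreeDelta_eq (r : Radicals F a b) :
    r.sqrtNegThreeDelta = (1 + 2 * r.ζ) * r.sqrtDelta ∨
      r.sqrtNegThreeDelta = -((1 + 2 * r.ζ) * r.sqrtDelta) := by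
  rw [← sq_eq_sq_iff_eq_or_eq_neg, r.sqrtNegThreeDelta_sq, mul_pow, r.sqrtDelta_sq, map_mul,
    map_neg, map_ofNat]
  linear_combination -4 * algebraMap K F (a ^ 2 - 4 * b) * r.zeta_sum

theorem Acts.map_one_add_zeta (hσ : r.Acts σ g) :
    σ (1 + 2 * r.ζ) = if tOf g = 0 then 1 + 2 * r.ζ else -(1 + 2 * r.ζ) := by
  have h2 := r.zeta_sum
  have ht := tOf_lt g
  simp only [map_add, map_one, map_mul, map_ofNat, hσ.zeta]
  interval_cases tOf g
  · simp
  · norm_num; linear_combination 2 * h2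

theorem Regular.one_add_zeta_ne (hr : r.Regular) : 1 + 2 * r.ζ ≠ 0 := by
  intro h
  exact hr.three_ne (by linear_combination 4 * r.zeta_sum - (1 + 2 * r.ζ) * h)

theorem neg_fix {x : F} : σ (-x) = -x ↔ σ x = x := by rw [map_neg, neg_inj]

theorem fixOK_sqrtDelta (hr : r.Regular) : r.FixOK .sqrtDelta := by
  intro σ g hσ
  simp only [eval, hσ.map_sqrtDelta hr, Sym.fixes, beq_iff_eq]
  have := hr.neg_eq_self hr.sqrtDelta_ne
  split_ifs with h <;> simp [h, this]

theorem fixOK_zeta (r : Radicals F a b) : r.FixOK .zeta := by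
  intro σ g hσ
  have ht := tOf_lt g
  have : σ r.ζ = r.ζ ^ 1 ↔ tOf g = 0 := by
    rw [hσ.zeta, zeta_pow_inj]; omega
  simpa [eval, Sym.fixes] using this

theorem fixOK_sqrtNegThree (hr : r.Regular) : r.FixOK .sqrtNegThree := by
  intro σ g hσ
  have h : σ r.sqrtNegThree = r.sqrtNegThree ↔ σ (1 + 2 * r.ζ) = 1 + 2 * r.ζ := by
    rcases r.sqrtNegThree_eq with h | h <;> rw [h]
    exact neg_fix
  simp only [eval, h, hσ.map_one_add_zeta, Sym.fixes, beq_iff_eq]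
  have := hr.neg_eq_self hr.one_add_zeta_ne
  split_ifs with h <;> simp only [h, this]

theorem fixOK_sqrtNegThreeDelta (hr : r.Regular) : r.FixOK .sqrtNegThreeDelta := by
  intro σ g hσ
  have h : σ r.sqrtNegThreeDelta = r.sqrtNegThreeDelta ↔
      σ ((1 + 2 * r.ζ) * r.sqrtDelta) = (1 + 2 * r.ζ) * r.sqrtDelta := by
    rcases r.sqrtNegThreeDelta_eq with h | h <;> rw [h]
    exact neg_fix
  simp only [eval, h, map_mul σ, hσ.map_one_add_zeta, hσ.map_sqrtDelta hr, Sym.fixes, beq_iff_eq]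
  have hne := hr.neg_eq_self (mul_ne_zero hr.one_add_zeta_ne hr.sqrtDelta_ne)
  have hs := sOf_lt hσ.lt
  have ht := tOf_lt g
  split_ifs with h h' h'
  · simp [h, h']
  · simp only [mul_neg, hne, false_iff]; omega
  · simp only [neg_mul, hne, false_iff]; omega
  · simp only [neg_mul_neg, true_iff]; omega

theorem fixOK_cbrt (hr : r.Regular) (k : Fin 3) : r.FixOK (.cbrt k) := by
  intro σ g hσ
  have hk := k.2
  rw [eval_cbrt, map_mul, hσ.map_cbrt, hσ.map_zeta_pow, mul_right_comm, ← pow_add, mul_comm,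
    mul_right_inj' hr.cbrt_ne, zeta_pow_inj, Sym.fixes, beq_iff_eq, Nat.mod_eq_of_lt hk]

theorem fixOK_alpha (hr : r.Regular) (k : Fin 3) : r.FixOK (.alpha k) := by
  intro σ g hσ
  have hk := k.2
  rw [eval_alpha, map_mul, hσ.alpha, hσ.map_zeta_pow, Sym.fixes, Bool.and_eq_true, beq_iff_eq,
    beq_iff_eq]
  split_ifs with h
  · rw [mul_right_comm, ← pow_add, mul_comm, mul_right_inj' hr.α_ne, zeta_pow_inj,
      Nat.mod_eq_of_lt hk]
    simp [h]
  · simp only [h, false_and, iff_false]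
    intro h'
    apply hr.α_cube_ne
    have h3 := congrArg (· ^ 3) h'
    simp only [mul_pow, ← pow_mul, mul_comm _ 3, pow_mul _ 3, r.zeta_pow, one_pow] at h3
    linear_combination -h3

theorem fixOK_beta (hr : r.Regular) (k : Fin 3) : r.FixOK (.beta k) := by
  intro σ g hσ
  have hk := k.2
  rw [eval_beta, map_mul, hσ.beta, hσ.map_zeta_pow, Sym.fixes, Bool.and_eq_true, beq_iff_eq,
    beq_iff_eq]
  split_ifs with h
  · rw [mul_right_comm, ← pow_add, mul_comm, mul_right_inj' hr.β_ne, zeta_pow_inj,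
      Nat.mod_eq_of_lt hk]
    simp [h]
  · simp only [h, false_and, iff_false]
    intro h'
    apply hr.α_cube_ne
    have h3 := congrArg (· ^ 3) h'
    simp only [mul_pow, ← pow_mul, mul_comm _ 3, pow_mul _ 3, r.zeta_pow, one_pow] at h3
    linear_combination h3

/-- The factor ζ^d stands for what σ does to `cbrt` in a root of R; d = 0 is the case of a bare sum.
-/
theorem zeta_pow_mul_map_sum (hr : r.Regular) (ha : a ≠ 0) (hσ : r.Acts σ g) (d : ℕ) {u v : ℕ}
    (hu : u < 3) (hv : v < 3) :
    r.ζ ^ d * σ (r.sum u v) = r.sum u v ↔ fixesSum d u v g = true := by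
  rw [hσ.map_sum, fixesSum]
  split_ifs <;>
  simp only [zeta_pow_mul_sum, hr.sum_inj ha, Nat.mod_eq_of_lt hu, Nat.mod_eq_of_lt hv,
    Bool.and_eq_true, beq_iff_eq, ← add_assoc]
  exact and_comm

theorem fixOK_sum (hr : r.Regular) (ha : a ≠ 0) (u v : Fin 3) : r.FixOK (.sum u v) := by
  intro σ g hσ
  rw [eval_sum, Sym.fixes, ← zeta_pow_mul_map_sum hr ha hσ 0 u.2 v.2, pow_zero, one_mul]

theorem fixOK_rho (hr : r.Regular) (ha : a ≠ 0) (k : Fin 3) : r.FixOK (.rho k) := by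
  intro σ g hσ
  have h : r.sum k (2 * k) = r.sum k (2 * k % 3) := by
    simp [sum, zeta_pow_mod]
  rw [eval_rho, h, Sym.fixes, ← zeta_pow_mul_map_sum hr ha hσ _ k.2 (Nat.mod_lt _ (by norm_num)),
    map_mul, hσ.map_cbrt, mul_comm (_ ^ _), mul_assoc, mul_right_inj' hr.cbrt_ne]

theorem Regular.sub_inj (hr : r.Regular) (ha : a ≠ 0) {u v u' v' : ℕ} :
    r.sub u v = r.sub u' v' ↔ u % 3 = u' % 3 ∧ v % 3 = v' % 3 := by
  rw [← and_congr_right' eq_comm, ← hr.sum_inj ha, sub, sub, sum, sum, sub_eq_sub_iff_add_eq_add]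

/-- Equality would mean α(ζ^u + ζ^u') = β(ζ^v + ζ^v'). A sum of two powers of ζ has cube 8 or -1, so
α³ = β³, or 8α³ = -β³, or α³ = -8β³. Together with α³ + β³ = -a, the last two put seven times α³ or
β³ in K. -/
theorem Regular.sub_ne_neg (hr : r.Regular) (ha : a ≠ 0) (u v u' v' : ℕ) :
    r.sub u v ≠ -r.sub u' v' := by
  intro h
  have h1 : r.α * (r.ζ ^ u + r.ζ ^ u') = r.β * (r.ζ ^ v + r.ζ ^ v') := by
    simp only [sub] at h; linear_combination h
  have key : ∀ m n : ℕ, (r.ζ ^ m + r.ζ ^ n) ^ 3 = if m % 3 = n % 3 then 8 else -1 := by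
    intro m n
    rw [← r.zeta_pow_mod m, ← r.zeta_pow_mod n]
    have hm : m % 3 < 3 := Nat.mod_lt _ (by norm_num)
    have hn : n % 3 < 3 := Nat.mod_lt _ (by norm_num)
    have h3 := r.zeta_pow
    have h1 := r.zeta_sum
    have ha : 1 + r.ζ = -r.ζ ^ 2 := by linear_combination h1
    have hb : 1 + r.ζ ^ 2 = -r.ζ := by linear_combination h1
    have hc : r.ζ + r.ζ ^ 2 = -1 := by linear_combination h1
    interval_cases m % 3 <;> interval_cases n % 3 <;> norm_num [ha, hb, hc, add_comm _ (1 : F)]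
    · linear_combination (-r.ζ ^ 3 - 1) * h3
    · linear_combination -h3
    · linear_combination (-r.ζ ^ 3 - 1) * h3
    · linear_combination 8 * h3
    · linear_combination -h3
    · rw [add_comm, hc]; norm_num
    · linear_combination (8 * r.ζ ^ 3 + 8) * h3
  have h3 := congrArg (· ^ 3) h1
  simp only [mul_pow, key] at h3
  have hne := hr.cube_ne_neg ha
  have hne' := hr.α_cube_ne
  have hadd := hr.cube_add
  have h7 : ∀ x : F, x ∉ (algebraMap K F).range → 7 * x = algebraMap K F a ∨
      7 * x = -algebraMap K F a → False := by
    intro x hx hx7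
    -- Characteristic 7 is separate: there the relation gives a = 0 instead of x ∈ K.
    by_cases h : (7 : F) = 0
    · rw [h, zero_mul] at hx7
      exact ha ((map_eq_zero (algebraMap K F)).1 (by
        rcases hx7 with h | h
        · exact h.symm
        · exact (neg_eq_zero.1 h.symm)))
    · rcases hx7 with h' | h'
      · exact hx ⟨a / 7, by rw [map_div₀, map_ofNat, ← h']; field_simp⟩
      · exact hx ⟨-a / 7, by rw [map_div₀, map_neg, map_ofNat, ← h']; field_simp⟩
  have h8 : (8 : F) ≠ 0 := by
    rw [show (8 : F) = 2 ^ 3 by norm_num]; exact pow_ne_zero 3 hr.two_ne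
  split_ifs at h3
  · exact hne' (mul_right_cancel₀ h8 h3)
  · exact h7 _ hr.α_cube_notMem (.inl (by linear_combination h3 - hadd))
  · exact h7 _ hr.β_cube_notMem (.inl (by linear_combination -h3 - hadd))
  · exact hne' (by linear_combination -h3)

/-- Inverting ζ multiplies ζ - 1 by -ζ², and exchanging α and β puts a sign on their difference. The
signs must cancel, which forces s = t and leaves the twist by ζ^(2t). -/
theorem fixOK_diff (hr : r.Regular) (ha : a ≠ 0) (k : Fin 3) : r.FixOK (.diff k) := by
  intro σ g hσ
  have h1 : r.ζ - 1 ≠ 0 := sub_ne_zero.2 (r.isPrimitiveRoot_ζ.ne_one (by norm_num))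
  have hs := sOf_lt hσ.lt
  have ht := tOf_lt g
  have hk := k.2
  have hz : σ (r.ζ - 1) = (r.ζ - 1) * if tOf g = 0 then r.ζ ^ (2 * tOf g) else
      -r.ζ ^ (2 * tOf g) := by
    rw [_root_.map_sub, map_one, hσ.zeta]
    interval_cases tOf g
    · simp
    · norm_num
      linear_combination r.zeta_pow
  rw [eval_diff, map_mul, hz, hσ.map_sub, Sym.fixes, mul_assoc, mul_right_inj' h1,
    Bool.and_eq_true, beq_iff_eq, fixesSum]
  split_ifs with h h' h'
  · simp only [zeta_pow_mul_sub, hr.sub_inj ha, h, h', Nat.mod_eq_of_lt hk, Bool.and_eq_true,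
      beq_iff_eq, ← add_assoc, true_and]
  · simp only [zeta_pow_mul_sub, mul_neg, (hr.sub_ne_neg ha _ _ _ _).symm, false_iff]
    omega
  · simp only [zeta_pow_mul_sub, neg_mul, (hr.sub_ne_neg ha _ _ _ _).symm, false_iff]
    omega
  · simp only [zeta_pow_mul_sub, neg_mul_neg, hr.sub_inj ha, Nat.mod_eq_of_lt hk,
      Bool.and_eq_true, beq_iff_eq, ← add_assoc]
    have : sOf g = tOf g := by omega
    simp only [this, true_and]
    exact and_comm

theorem fixOK_of_ne_zero (hr : r.Regular) (ha : a ≠ 0) : ∀ s, r.FixOK s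
  | .sqrtDelta => fixOK_sqrtDelta hr
  | .zeta => fixOK_zeta r
  | .sqrtNegThree => fixOK_sqrtNegThree hr
  | .sqrtNegThreeDelta => fixOK_sqrtNegThreeDelta hr
  | .cbrt k => fixOK_cbrt hr k
  | .rho k => fixOK_rho hr ha k
  | .alpha k => fixOK_alpha hr k
  | .beta k => fixOK_beta hr k
  | .sum u v => fixOK_sum hr ha u v
  | .diff k => fixOK_diff hr ha k

/-! ### Masks and the Galois correspondence -/

/-- The set of codes in the mask `m` is that of the automorphisms fixing `L`. -/
def HasMask (r : Radicals F a b) (L : IntermediateField K F) (m : ℕ) : Prop :=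
  ∀ x, m.testBit x = true ↔ ∃ σ ∈ L.fixingSubgroup, r.Acts σ x

variable {L L' : IntermediateField K F} {m m' H : ℕ}

theorem exists_hasMask (r : Radicals F a b) (L : IntermediateField K F) :
    ∃ m ∈ subgroupMasks, r.HasMask L m := by
  refine exists_mem_subgroupMasks (T := fun x => ∃ σ ∈ L.fixingSubgroup, r.Acts σ x)
    ⟨1, one_mem _, Acts.one r⟩ ?_ ?_
  · rintro x y ⟨σ, hσ, hx⟩ ⟨τ, hτ, hy⟩
    exact ⟨σ * τ, mul_mem hσ hτ, hx.mul hy⟩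
  · rintro x ⟨σ, -, hx⟩
    exact hx.lt

theorem HasMask.unique (h : r.HasMask L m) (h' : r.HasMask L m') : m = m' :=
  Nat.eq_of_testBit_eq fun x => Bool.eq_iff_iff.2 ((h x).trans (h' x).symm)

/-- The elements of a list of generators. -/
def gens (r : Radicals F a b) : List Sym → Set F
  | [] => ∅
  | [x] => {r.eval x}
  | x :: y :: l => insert (r.eval x) (gens r (y :: l))

theorem mem_gens (r : Radicals F a b) (x : F) : ∀ l : List Sym, x ∈ r.gens l ↔ ∃ s ∈ l, r.eval s = x
  | [] => by simp [gens]
  | [y] => by simp [gens, eq_comm]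
  | y :: z :: l => by
    rw [gens, Set.mem_insert_iff, mem_gens r x (z :: l)]
    simp [eq_comm]

/-- The field generated by a list of generators. -/
def fieldOf (r : Radicals F a b) (l : List Sym) : IntermediateField K F := adjoin K (r.gens l)

/-- The row denoted by a symbolic row. -/
def rowOf (r : Radicals F a b) (R : SymRow) : Row K F :=
  ⟨R.degree, R.normal.map r.fieldOf, R.nonNormal.map r.fieldOf⟩

theorem mem_fixingSubgroup_fieldOf (r : Radicals F a b) (l : List Sym) (σ : Gal(F/K)) :
    σ ∈ (r.fieldOf l).fixingSubgroup ↔ ∀ s ∈ l, σ (r.eval s) = r.eval s := by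
  -- Passing to the cyclic group generated by σ lets the Galois connection reduce the claim to the
  -- generators.
  rw [← Subgroup.zpowers_le, ← le_iff_le, fieldOf, adjoin_le_iff]
  constructor
  · intro h s hs
    exact h ((r.mem_gens _ l).2 ⟨s, hs, rfl⟩) ⟨σ, Subgroup.mem_zpowers σ⟩
  · intro h x hx
    obtain ⟨s, hs, rfl⟩ := (r.mem_gens _ l).1 hx
    rintro ⟨τ, hτ⟩
    have : Subgroup.zpowers σ ≤ MulAction.stabilizer Gal(F/K) (r.eval s) := by
      rw [Subgroup.zpowers_le, MulAction.mem_stabilizer_iff]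
      exact h s hs
    exact this hτ

theorem hasMask_fieldOf (hH : r.HasMask ⊥ H) {l : List Sym} (hl : ∀ s ∈ l, r.FixOK s) :
    r.HasMask (r.fieldOf l) (H &&& stabMask l) := by
  intro x
  simp only [Nat.testBit_and, Bool.and_eq_true, hH x, testBit_stabMask,
    mem_fixingSubgroup_fieldOf, fixingSubgroup_bot, Subgroup.mem_top, true_and]
  constructor
  · rintro ⟨⟨σ, hσ⟩, -, h⟩
    exact ⟨σ, fun s hs => (hl s hs σ x hσ).2 (h s hs), hσ⟩
  · rintro ⟨σ, h, hσ⟩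
    exact ⟨⟨σ, hσ⟩, hσ.lt, fun s hs => (hl s hs σ x hσ).1 (h s hs)⟩

theorem HasMask.card (hr : r.Regular) (hF : (sextic a b).IsSplittingField K F)
    (h : r.HasMask L m) : Nat.card L.fixingSubgroup = (bits m).length := by
  have hnd : (bits m).Nodup := List.nodup_range.filter _
  rw [← List.toFinset_card_of_nodup hnd, ← Nat.card_eq_finsetCard]
  choose c hc using fun σ : Gal(F/K) => r.exists_acts σ
  have hmem : ∀ x, x ∈ (bits m).toFinset ↔ ∃ σ ∈ L.fixingSubgroup, r.Acts σ x := fun x => by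
    rw [List.mem_toFinset, mem_bits, h x]
    exact ⟨And.right, fun hx => ⟨hx.choose_spec.2.lt, hx⟩⟩
  refine Nat.card_congr (Equiv.ofBijective
    (fun σ => ⟨c σ, (hmem _).2 ⟨σ, σ.2, hc _⟩⟩) ⟨?_, ?_⟩)
  · intro σ τ hστ
    have : c σ = c τ := congrArg Subtype.val hστ
    exact Subtype.ext ((hc σ).unique hr hF (this ▸ hc τ))
  · rintro ⟨x, hx⟩
    obtain ⟨σ, hσ, hσx⟩ := (hmem x).1 hx
    exact ⟨⟨σ, hσ⟩, Subtype.ext ((hc σ).code_unique hr hσx)⟩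

theorem HasMask.mem_iff (hr : r.Regular) (hF : (sextic a b).IsSplittingField K F)
    (h : r.HasMask L m) {σ : Gal(F/K)} {g : ℕ} (hσ : r.Acts σ g) :
    σ ∈ L.fixingSubgroup ↔ m.testBit g = true := by
  rw [h g]
  refine ⟨fun h' => ⟨σ, h', hσ⟩, ?_⟩
  rintro ⟨τ, hτ, hτg⟩
  rwa [hσ.unique hr hF hτg]

theorem hasMask_top (hr : r.Regular) : r.HasMask (⊤ : IntermediateField K F) 1 := by
  intro x
  simp only [Nat.testBit_one_eq_true_iff_self_eq_zero, fixingSubgroup_top, Subgroup.mem_bot,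
    exists_eq_left]
  exact ⟨by rintro rfl; exact Acts.one r, fun h => h.code_unique hr (Acts.one r)⟩

theorem HasMask.normal_iff [IsGalois K F] (hr : r.Regular) (hF : (sextic a b).IsSplittingField K F)
    (hH : r.HasMask ⊥ H) (h : r.HasMask L m) : Normal K L ↔ normalMask H m = true := by
  have hn : Normal K L ↔ L.fixingSubgroup.Normal := by
    rw [InfiniteGalois.normal_iff_isGalois]
    exact ⟨fun _ => ⟨⟩, fun _ => inferInstance⟩
  have hinv : ∀ {σ : Gal(F/K)} {g : ℕ}, r.Acts σ g → r.Acts σ⁻¹ (invCode g) := by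
    intro σ g hσ
    obtain ⟨k, hk⟩ := r.exists_acts σ⁻¹
    have h1 := hσ.mul hk
    rw [mul_inv_cancel] at h1
    have h2 := h1.code_unique hr (Acts.one r)
    have hcancel : ∀ g < 36, ∀ k < 36, mulCode g k = 0 → k = invCode g := by decide +kernel
    rwa [← hcancel g hσ.lt k hk.lt h2]
  have hmem : ∀ {m L}, r.HasMask L m → ∀ x, x ∈ bits m ↔ ∃ σ ∈ L.fixingSubgroup, r.Acts σ x :=
    fun {m L} h x => by
      rw [mem_bits, h x]
      exact ⟨And.right, fun hx => ⟨hx.choose_spec.2.lt, hx⟩⟩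
  simp only [hn, normalMask, List.all_eq_true, hmem h, hmem hH]
  constructor
  · rintro hN x ⟨σ, hσ, hx⟩ y ⟨τ, -, hy⟩
    exact (h.mem_iff hr hF ((hy.mul hx).mul (hinv hy))).1 (hN.conj_mem σ hσ τ)
  · refine fun hall => ⟨fun σ hσ τ => ?_⟩
    obtain ⟨x, hx⟩ := r.exists_acts σ
    obtain ⟨y, hy⟩ := r.exists_acts τ
    exact (h.mem_iff hr hF ((hy.mul hx).mul (hinv hy))).2
      (hall x ⟨σ, hσ, hx⟩ y ⟨τ, by simp, hy⟩)

section Galois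

variable [FiniteDimensional K F] [IsGalois K F]

theorem HasMask.field_unique (hr : r.Regular) (hF : (sextic a b).IsSplittingField K F)
    (h : r.HasMask L m) (h' : r.HasMask L' m) : L = L' := by
  rw [← IsGalois.fixedField_fixingSubgroup L, ← IsGalois.fixedField_fixingSubgroup L']
  congr 1
  ext σ
  obtain ⟨g, hg⟩ := r.exists_acts σ
  rw [h.mem_iff hr hF hg, h'.mem_iff hr hF hg]

theorem HasMask.finrank (hr : r.Regular) (hF : (sextic a b).IsSplittingField K F)
    (hH : r.HasMask ⊥ H) (h : r.HasMask L m) {d : ℕ}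
    (hd : (bits H).length = d * (bits m).length) : Module.finrank K L = d := by
  have h1 := IsGalois.card_fixingSubgroup_eq_finrank L
  have h2 := IsGalois.card_fixingSubgroup_eq_finrank (⊥ : IntermediateField K F)
  rw [h.card hr hF] at h1
  rw [hH.card hr hF, finrank_bot', hd, ← Module.finrank_mul_finrank K L F, h1] at h2
  exact (Nat.eq_of_mul_eq_mul_right Module.finrank_pos h2).symm

/-- Field and mask determine each other, so distinctness, properness, degree and normality can all
be tested on masks. Exhaustiveness holds because any intermediate field has one of the sixty masks,
and that mask lies inside H. -/
theorem isCompleteList (hr : r.Regular) (hF : (sextic a b).IsSplittingField K F)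
    (hH : r.HasMask ⊥ H) {T : List SymRow}
    (hT : ∀ R ∈ T, ∀ l ∈ R.normal ++ R.nonNormal, ∀ s ∈ l, r.FixOK s)
    (hc : completeFor H T = true) : IsCompleteList (T.map r.rowOf) := by
  have hmask : ∀ R ∈ T, ∀ l ∈ R.normal ++ R.nonNormal,
      r.HasMask (r.fieldOf l) (H &&& stabMask l) :=
    fun R hR l hl => hasMask_fieldOf hH (hT R hR l hl)
  simp only [completeFor, Bool.and_eq_true, decide_eq_true_eq, List.all_eq_true, bne_iff_ne,
    Bool.or_eq_true, Bool.not_eq_true', beq_eq_false_iff_ne, beq_iff_eq, List.contains_iff_mem,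
    SymRow.masks, List.mem_map, forall_exists_index, and_imp, forall_apply_eq_imp_iff₂] at hc
  obtain ⟨⟨⟨hnd, hproper⟩, hall⟩, hrows⟩ := hc
  have hfields : (T.map r.rowOf).flatMap Row.fields =
      (T.flatMap fun R => R.normal ++ R.nonNormal).map r.fieldOf := by
    simp [List.flatMap_map, List.map_flatMap, Row.fields, rowOf]
  have hmasks : (T.flatMap (SymRow.masks H)) =
      (T.flatMap fun R => R.normal ++ R.nonNormal).map fun l => H &&& stabMask l := by
    rw [List.map_flatMap]; rfl
  change (T.flatMap (SymRow.masks H)).Nodup at hnd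
  change ∀ x ∈ T.flatMap (SymRow.masks H), _ at hproper
  change ∀ x ∈ subgroupMasks, _ ∨ x ∈ T.flatMap (SymRow.masks H) at hall
  rw [hmasks] at hnd hproper hall
  have hmask' : ∀ l ∈ (T.flatMap fun R => R.normal ++ R.nonNormal),
      r.HasMask (r.fieldOf l) (H &&& stabMask l) := by
    intro l hl
    obtain ⟨R, hR, hl⟩ := List.mem_flatMap.1 hl
    exact hmask R hR l hl
  refine ⟨?_, ?_, ?_, ?_, ?_⟩
  · rw [hfields]
    have hnd' := List.Nodup.of_map _ hnd
    refine (List.nodup_map_iff_inj_on hnd').2 fun l hl l' hl' h => ?_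
    refine List.inj_on_of_nodup_map hnd hl hl' ?_
    exact (hmask' l hl).unique (h ▸ hmask' l' hl')
  · intro L
    rw [hfields, List.mem_map]
    constructor
    · rintro ⟨l, hl, rfl⟩
      have hp := hproper _ (List.mem_map_of_mem hl)
      refine ⟨fun h => hp.2 ?_, fun h => hp.1 ?_⟩
      · exact (hmask' l hl).unique (h ▸ hH)
      · exact (hmask' l hl).unique (h ▸ hasMask_top hr)
    · rintro ⟨hbot, htop⟩
      obtain ⟨m, hm, hLm⟩ := r.exists_hasMask L
      rcases hall m hm with ((h | h) | h) | h
      · refine absurd (Nat.eq_of_testBit_eq fun x => ?_) h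
        rw [Nat.testBit_and, Bool.eq_iff_iff, Bool.and_eq_true, hH x, hLm x]
        simp only [fixingSubgroup_bot, Subgroup.mem_top, true_and, and_iff_right_iff_imp]
        exact fun ⟨σ, _, hσ⟩ => ⟨σ, hσ⟩
      · exact absurd (hLm.field_unique hr hF (h ▸ hasMask_top hr)) htop
      · exact absurd (hLm.field_unique hr hF (h ▸ hH)) hbot
      · obtain ⟨l, hl, rfl⟩ := List.mem_map.1 h
        exact ⟨l, hl, (hmask' l hl).field_unique hr hF hLm⟩
  · intro R hR L hL
    obtain ⟨R, hRT, rfl⟩ := List.mem_map.1 hR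
    rw [Row.fields, rowOf, ← List.map_append] at hL
    obtain ⟨l, hl, rfl⟩ := List.mem_map.1 hL
    exact hH.finrank hr hF (hmask R hRT l hl) ((hrows R hRT).1.1 l hl)
  · intro R hR L hL
    obtain ⟨R, hRT, rfl⟩ := List.mem_map.1 hR
    obtain ⟨l, hl, rfl⟩ := List.mem_map.1 hL
    rw [hH.normal_iff hr hF (hmask R hRT l (List.mem_append_left _ hl))]
    exact (hrows R hRT).1.2 l hl
  · intro R hR L hL
    obtain ⟨R, hRT, rfl⟩ := List.mem_map.1 hR
    obtain ⟨l, hl, rfl⟩ := List.mem_map.1 hL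
    rw [hH.normal_iff hr hF (hmask R hRT l (List.mem_append_right _ hl)), Bool.not_eq_true]
    exact (hrows R hRT).2 l hl

end Galois

theorem nonempty_mulEquiv (hr : r.Regular) (hF : (sextic a b).IsSplittingField K F)
    (hH : r.HasMask ⊥ H) {X : Type*} [Group X] {e : X → ℕ} (he : IsoCode e H) :
    Nonempty (Gal(F/K) ≃* X) := by
  obtain ⟨hmul, hinj, hmem, hsurj⟩ := he
  choose f hf using fun x => ((hH (e x)).1 (hmem x))
  refine ⟨(MulEquiv.ofBijective (MonoidHom.mk' f fun x y => ?_)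
    ⟨fun x y hxy => ?_, fun σ => ?_⟩).symm⟩
  · exact ((hmul x y ▸ (hf (x * y)).2)).unique hr hF ((hf x).2.mul (hf y).2)
  · refine hinj x y ((hf x).2.code_unique hr ?_)
    have : f x = f y := hxy
    exact this ▸ (hf y).2
  · obtain ⟨g, hg⟩ := r.exists_acts σ
    obtain ⟨x, rfl⟩ := hsurj g hg.lt ((hH g).2 ⟨σ, by simp, hg⟩)
    exact ⟨x, (hf x).2.unique hr hF hg⟩

end Radicals

theorem IsCompleteList.ncard {T : List (Row K F)} (h : IsCompleteList T) :
    (properSubfields K F).ncard = (T.flatMap Row.fields).length := by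
  classical
  have : properSubfields K F = (T.flatMap Row.fields).toFinset := by
    ext L
    rw [← h.mem_iff L]; simp
  rw [this, Set.ncard_coe_finset, List.toFinset_card_of_nodup h.nodup]

/-! ### The case conditions as conditions on the mask -/

theorem cubicR_irreducible_iff :
    Irreducible (cubicR a b) ↔ ∀ x : K, x ^ 3 - 3 * b * x + a * b ≠ 0 := by
  have hdeg : (cubicR a b).natDegree = 3 := by unfold cubicR; compute_degree!
  have hne : cubicR a b ≠ 0 := fun h => by rw [h] at hdeg; simp at hdeg
  rw [irreducible_iff_roots_eq_zero_of_degree_le_three (by omega) (by omega),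
    Multiset.eq_zero_iff_forall_notMem]
  refine forall_congr' fun x => ?_
  rw [mem_roots hne, IsRoot.def]
  simp [cubicR]

/-- For a = 0 the cubic has the root 0. This confines the degenerate relation α³ = -β³ to the cases
with R reducible. -/
theorem ne_zero_of_irreducible_cubicR (h : Irreducible (cubicR a b)) : a ≠ 0 := by
  rintro rfl
  exact cubicR_irreducible_iff.1 h 0 (by simp)

namespace Radicals

variable {r : Radicals F a b} {H : ℕ}

theorem mem_range_of_allFix [FiniteDimensional K F] [IsGalois K F] (hH : r.HasMask ⊥ H) {s : Sym}
    (hs : r.FixOK s) : allFix H s = true ↔ r.eval s ∈ (algebraMap K F).range := by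
  have : r.eval s ∈ (algebraMap K F).range ↔ ∀ σ : Gal(F/K), σ (r.eval s) = r.eval s :=
    IsGalois.mem_range_algebraMap_iff_fixed (r.eval s)
  simp only [this, allFix, List.all_eq_true, mem_bits, hH _, fixingSubgroup_bot, Subgroup.mem_top,
    true_and, and_imp]
  constructor
  · intro h σ
    obtain ⟨g, hg⟩ := r.exists_acts σ
    exact (hs σ g hg).2 (h g hg.lt ⟨σ, hg⟩)
  · rintro h g - ⟨σ, hσ⟩
    exact (hs σ g hσ).1 (h σ)

theorem allFix_of_forall (hH : r.HasMask ⊥ H) {s : Sym}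
    (h : ∀ (σ : Gal(F/K)) (g : ℕ), r.Acts σ g → s.fixes g = true) : allFix H s = true := by
  simp only [allFix, List.all_eq_true, mem_bits, hH _]
  rintro x ⟨-, σ, -, hσ⟩
  exact h σ x hσ

/-- An exchange of α and β exists since √Δ ∉ K. The elements αζ^i share the minimal polynomial of α,
so some automorphism carries α to each; it cannot exchange the cubes because α³ ≠ β³. -/
theorem transMask_eq_true [FiniteDimensional K F] [IsGalois K F] (hr : r.Regular)
    (hf : Irreducible (sextic a b)) (hH : r.HasMask ⊥ H) : transMask H = true := by
  have key : ∀ {p : ℕ → Bool}, ((bits H).any p) = true ↔ ∃ (σ : Gal(F/K)) (g : ℕ),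
      r.Acts σ g ∧ p g = true := by
    intro p
    simp only [List.any_eq_true, mem_bits, hH _, fixingSubgroup_bot, Subgroup.mem_top, true_and]
    exact ⟨fun ⟨g, ⟨_, σ, h⟩, h'⟩ => ⟨σ, g, h, h'⟩, fun ⟨σ, g, h, h'⟩ => ⟨g, ⟨h.lt, σ, h⟩, h'⟩⟩
  rw [transMask, Bool.and_eq_true, key]
  simp only [List.all_eq_true, key, List.mem_range]
  constructor
  · have h := hr.sqrtDelta_notMem
    change ¬ r.eval .sqrtDelta ∈ _ at h
    rw [← mem_range_of_allFix hH (fixOK_sqrtDelta hr), allFix, List.all_eq_true] at h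
    push Not at h
    obtain ⟨x, hx, hs⟩ := h
    rw [mem_bits, hH x] at hx
    obtain ⟨hlt, σ, -, hσ⟩ := hx
    refine ⟨σ, x, hσ, ?_⟩
    have := sOf_lt hlt
    simp only [Sym.fixes, ne_eq, beq_iff_eq] at hs ⊢
    omega
  · intro i hi
    have h0 : aeval (r.α * r.ζ ^ i) (minpoly K r.α) = 0 := by
      rw [minpoly_eq_sextic hf hr.aeval_α, hr.aeval_sextic_eq, mul_pow, ← pow_mul, mul_comm i,
        pow_mul, r.zeta_pow, one_pow, mul_one, sub_self, zero_mul]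
    obtain ⟨σ, hσ⟩ := minpoly.exists_algEquiv_of_root' (Algebra.IsAlgebraic.isAlgebraic r.α) h0
    obtain ⟨g, hg⟩ := r.exists_acts σ
    refine ⟨σ, g, hg, ?_⟩
    rw [hg.alpha] at hσ
    have hcube := congrArg (· ^ 3) hσ
    simp only [mul_pow, ← pow_mul, mul_comm _ 3, pow_mul _ 3, r.zeta_pow, one_pow, one_mul,
      mul_one] at hcube
    split_ifs at hσ hcube with hs
    · rw [mul_comm, mul_right_inj' hr.α_ne, zeta_pow_inj] at hσ
      have := iOf_lt g
      simp only [Bool.and_eq_true, beq_iff_eq]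
      omega
    · exact absurd hcube.symm hr.α_cube_ne

theorem hasZeta_iff (r : Radicals F a b) : HasZeta K ↔ r.ζ ∈ (algebraMap K F).range := by
  constructor
  · rintro ⟨z, hz⟩
    have hz' := hz.map_of_injective (algebraMap K F).injective
    obtain ⟨i, -, hi⟩ := hz'.eq_pow_of_pow_eq_one r.zeta_pow
    exact ⟨z ^ i, by rw [map_pow, hi]⟩
  · rintro ⟨z, hz⟩
    exact ⟨z, IsPrimitiveRoot.of_map_of_injective (hz ▸ r.isPrimitiveRoot_ζ)
      (algebraMap K F).injective⟩

theorem deltaIsNegThreeSq_iff (hr : r.Regular) :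
    DeltaIsNegThreeSq a b ↔ r.sqrtNegThreeDelta ∈ (algebraMap K F).range := by
  have hsq := r.sqrtNegThreeDelta_sq
  have h3 : (3 : K) ≠ 0 := fun h => hr.three_ne (by
    rw [← map_ofNat (algebraMap K F) 3, h, map_zero])
  constructor
  · rintro ⟨n, hn⟩
    have : r.sqrtNegThreeDelta ^ 2 = algebraMap K F (3 * n) ^ 2 := by
      rw [hsq, hn, ← map_pow]; congr 1; ring
    rcases sq_eq_sq_iff_eq_or_eq_neg.1 this with h | h
    · exact ⟨3 * n, h.symm⟩
    · exact ⟨-(3 * n), by rw [h, map_neg]⟩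
  · rintro ⟨m, hm⟩
    rw [← hm, ← map_pow] at hsq
    refine ⟨m / 3, ?_⟩
    have := (algebraMap K F).injective hsq
    field_simp
    linear_combination this

theorem isCubeIn_iff (hr : r.Regular) :
    IsCubeIn b ↔ ∃ k : Fin 3, r.eval (.cbrt k) ∈ (algebraMap K F).range := by
  constructor
  · rintro ⟨x, hx⟩
    obtain ⟨i, hi, hxi⟩ := exists_pow_mul_of_cube_eq r.isPrimitiveRoot_ζ
      (x := algebraMap K F x) (y := r.cbrt) (by rw [hr.cbrt_cube, ← hx, map_pow])
    exact ⟨⟨i, hi⟩, x, by rw [hxi, eval_cbrt, mul_comm]⟩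
  · rintro ⟨k, x, hx⟩
    refine ⟨x, (algebraMap K F).injective ?_⟩
    rw [map_pow, hx, eval_cbrt, mul_pow, hr.cbrt_cube, ← pow_mul, mul_comm _ 3, pow_mul,
      r.zeta_pow, one_pow, mul_one]

/-- Cardano: with p = cα and q = cβ for c = αβ one has pq = b and p³ + q³ = -ab, and x³ - 3pqx - (p³
+ q³) splits as the product over k of x - (pζ^k + qζ^(2k)). -/
theorem cubicR_prod (hr : r.Regular) (x : F) :
    x ^ 3 - 3 * algebraMap K F b * x + algebraMap K F a * algebraMap K F b =
      (x - r.eval (.rho 0)) * ((x - r.eval (.rho 1)) * (x - r.eval (.rho 2))) := by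
  have h := hr.cube_add
  have hc := hr.cbrt_cube
  have h1 := r.zeta_sum
  have h3 := r.zeta_pow
  obtain ⟨p, hp⟩ : ∃ p, p = r.cbrt * r.α := ⟨_, rfl⟩
  obtain ⟨q, hq⟩ : ∃ q, q = r.cbrt * r.β := ⟨_, rfl⟩
  have hpq : p * q = algebraMap K F b := by
    rw [← hc, hp, hq]; unfold cbrt; ring
  have hsum : p ^ 3 + q ^ 3 = -(algebraMap K F a * algebraMap K F b) := by
    rw [hp, hq, ← hc]; linear_combination r.cbrt ^ 3 * h
  have key : ∀ z : F, 1 + z + z ^ 2 = 0 → x ^ 3 - 3 * (p * q) * x - (p ^ 3 + q ^ 3) =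
      (x - (p + q)) * ((x - (p * z + q * z ^ 2)) * (x - (p * z ^ 2 + q * z))) := by
    intro z hz
    have h2 : z ^ 2 = -1 - z := by linear_combination hz
    have : (x - (p * z + q * (-1 - z))) * (x - (p * (-1 - z) + q * z)) =
      x ^ 2 + (p + q) * x + (p ^ 2 - p * q + q ^ 2) := by
      linear_combination (-p ^ 2 - q ^ 2 + 2 * p * q) * hz
    rw [h2, this]; ring
  have := key r.ζ h1
  rw [hpq, hsum] at this
  simp only [eval]
  rw [hp, hq] at this
  linear_combination this

theorem not_irreducible_cubicR_iff (hr : r.Regular) :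
    ¬ Irreducible (cubicR a b) ↔ ∃ k : Fin 3, r.eval (.rho k) ∈ (algebraMap K F).range := by
  rw [cubicR_irreducible_iff]
  push Not
  have hx : ∀ x : K, x ^ 3 - 3 * b * x + a * b = 0 ↔
      ∃ k : Fin 3, algebraMap K F x = r.eval (.rho k) := by
    intro x
    rw [← map_eq_zero (algebraMap K F)]
    simp only [map_add, map_sub, map_mul, map_pow, map_ofNat]
    rw [cubicR_prod hr, mul_eq_zero, mul_eq_zero, sub_eq_zero, sub_eq_zero, sub_eq_zero]
    constructor
    · rintro (h | h | h)
      exacts [⟨0, h⟩, ⟨1, h⟩, ⟨2, h⟩]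
    · rintro ⟨k, h⟩
      fin_cases k
      exacts [.inl h, .inr (.inl h), .inr (.inr h)]
  simp only [hx]
  exact ⟨fun ⟨x, k, h⟩ => ⟨k, x, h⟩, fun ⟨k, x, h⟩ => ⟨x, k, h⟩⟩

/-! ### The degenerate case a = 0 -/

theorem exists_β_eq (hr : r.Regular) (ha : a = 0) : ∃ e < 3, r.β = -(r.ζ ^ e * r.α) := by
  have h := hr.cube_add
  rw [show algebraMap K F a = 0 by rw [ha, map_zero], neg_zero] at h
  obtain ⟨e, he, h⟩ := exists_pow_mul_of_cube_eq r.isPrimitiveRoot_ζ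
    (x := -r.β) (y := r.α) (by linear_combination -h)
  exact ⟨e, he, by rw [← h, neg_neg]⟩

/-- Applying σ to β = -ζ^e α ties j to i and t, so only part of the 36 codes can occur. -/
theorem Acts.code_of_β_eq (hr : r.Regular) {e : ℕ} (h : r.β = -(r.ζ ^ e * r.α)) {σ : Gal(F/K)}
    {g : ℕ} (hσ : r.Acts σ g) :
    (sOf g = 0 → (jOf g + e) % 3 = ((1 + tOf g) * e + iOf g) % 3) ∧
      (sOf g = 1 → jOf g % 3 = ((1 + tOf g) * e + iOf g + e) % 3) := by
  have h1 := congrArg σ h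
  rw [map_neg, map_mul, hσ.map_zeta_pow, hσ.alpha, hσ.beta] at h1
  constructor
  · intro hs
    rw [← zeta_pow_inj r]
    rw [if_pos hs, if_pos hs, h] at h1
    refine mul_right_cancel₀ hr.α_ne ?_
    simp only [pow_add]
    linear_combination -h1
  · intro hs
    rw [← zeta_pow_inj r]
    rw [if_neg (by omega), if_neg (by omega), h] at h1
    refine mul_right_cancel₀ hr.α_ne ?_
    simp only [pow_add]
    linear_combination h1

/-- The index k = 2e is the one for which ρ_k vanishes. Its being fixed as an element says nothing
about codes, so the formal statement is derived from the relation between i, j and t. -/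
theorem fixes_rho_of_β_eq (hr : r.Regular) {e : ℕ} {k : Fin 3} (h : r.β = -(r.ζ ^ e * r.α))
    (hk : (k : ℕ) = 2 * e % 3) {σ : Gal(F/K)} {g : ℕ} (hσ : r.Acts σ g) :
    (Sym.rho k).fixes g = true := by
  obtain ⟨h0, h1⟩ := hσ.code_of_β_eq hr h
  have hs := sOf_lt hσ.lt
  have ht := tOf_lt g
  rw [Sym.fixes, fixesSum]
  split_ifs with hs0
  · have := h0 hs0
    simp only [Bool.and_eq_true, beq_iff_eq]
    interval_cases tOf g <;> omega
  · have := h1 (by omega)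
    simp only [Bool.and_eq_true, beq_iff_eq]
    interval_cases tOf g <;> omega

theorem rootMask_iff [FiniteDimensional K F] [IsGalois K F] (hr : r.Regular)
    (hH : r.HasMask ⊥ H) : rootMask H = true ↔ ¬ Irreducible (cubicR a b) := by
  simp only [rootMask, List.any_eq_true, List.mem_finRange, true_and]
  by_cases ha : a = 0
  · refine iff_of_true ?_ fun h => ne_zero_of_irreducible_cubicR h ha
    obtain ⟨e, -, h⟩ := exists_β_eq hr ha
    exact ⟨⟨2 * e % 3, Nat.mod_lt _ (by norm_num)⟩,
      allFix_of_forall hH fun σ g hσ => fixes_rho_of_β_eq hr h rfl hσ⟩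
  · rw [not_irreducible_cubicR_iff hr]
    exact exists_congr fun k => mem_range_of_allFix hH (fixOK_rho hr ha k)

theorem cubeMask_iff [FiniteDimensional K F] [IsGalois K F] (hr : r.Regular)
    (hH : r.HasMask ⊥ H) : cubeMask H = true ↔ IsCubeIn b := by
  simp only [cubeMask, List.any_eq_true, List.mem_finRange, true_and]
  rw [isCubeIn_iff hr]
  exact exists_congr fun k => mem_range_of_allFix hH (fixOK_cbrt hr k)

/-- If `a = 0`, `Δ ≠ - 3 n ^ 2` and the root `cbrt b * (α + β)` of `R` lies in `K`, then
`β = - α`. -/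
theorem β_eq_neg (hr : r.Regular) (ha : a = 0) (hΔ : ¬ DeltaIsNegThreeSq a b)
    (hroot : r.RootRMem) : r.β = -r.α := by
  obtain ⟨e, he, h⟩ := exists_β_eq hr ha
  rw [deltaIsNegThreeSq_iff hr] at hΔ
  have h1 := r.zeta_sum
  have h3 := r.zeta_pow
  have hsub := hr.cube_sub
  have hadd := hr.cube_add
  rw [show algebraMap K F a = 0 by rw [ha, map_zero], neg_zero] at hadd
  obtain ⟨x, hx⟩ := hroot
  have hfalse : r.sqrtNegThreeDelta = algebraMap K F (2 * x) ∨
      r.sqrtNegThreeDelta = -algebraMap K F (2 * x) → False := by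
    rintro (h | h)
    · exact hΔ ⟨2 * x, h.symm⟩
    · exact hΔ ⟨-(2 * x), by rw [h, map_neg]⟩
  rw [map_mul, map_ofNat, hx, cbrt] at hfalse
  have hα : 2 * r.α ^ 3 = r.sqrtDelta := by linear_combination hsub + hadd
  have hΔeq := r.sqrtNegThreeDelta_eq
  rw [← hα] at hΔeq
  rw [h] at hfalse ⊢
  interval_cases e
  · simp
  -- For e = 1 and e = 2, twice the given root of R equals ±(1 + 2ζ)√Δ, which is √(-3Δ) up to sign.
  -- It would lie in K, against the hypothesis on Δ.
  · exfalso
    have : 2 * (r.α * -(r.ζ ^ 1 * r.α) * (r.α + -(r.ζ ^ 1 * r.α))) =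
        -((1 + 2 * r.ζ) * (2 * r.α ^ 3)) := by
      linear_combination 2 * r.α ^ 3 * h1
    rw [this, neg_neg] at hfalse
    exact hfalse hΔeq.symm
  · exfalso
    have : 2 * (r.α * -(r.ζ ^ 2 * r.α) * (r.α + -(r.ζ ^ 2 * r.α))) =
        (1 + 2 * r.ζ) * (2 * r.α ^ 3) := by
      linear_combination -2 * r.α ^ 3 * h1 + 2 * r.α ^ 3 * r.ζ * h3
    rw [this] at hfalse
    exact hfalse hΔeq

/-- For `β = - α` the automorphisms fixing a sum `α ζ ^ u + β ζ ^ v` with `u ≠ v` are those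
whose codes fix it formally. -/
theorem fixOK_sum_of_β_eq_neg (hr : r.Regular) (h : r.β = -r.α) {u v : Fin 3} (huv : u ≠ v) :
    r.FixOK (.sum u v) := by
  intro σ g hσ
  have hu := u.2
  have hv := v.2
  have huv' : (u : ℕ) ≠ v := fun h => huv (Fin.ext h)
  have hinj : ∀ {m n m' n' : ℕ}, m % 3 ≠ n % 3 → m' % 3 ≠ n' % 3 →
      (r.sum m n = r.sum m' n' ↔ m % 3 = m' % 3 ∧ n % 3 = n' % 3) := by
    intro m n m' n' hmn hmn'
    constructor
    · intro hs
      have h1 : r.ζ ^ m - r.ζ ^ n = r.ζ ^ m' - r.ζ ^ n' := by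
        refine mul_left_cancel₀ hr.α_ne ?_
        simp only [sum, h] at hs
        linear_combination hs
      -- The cube of ζ^m - ζ^n with m ≠ n shows, through its sign, whether n - m is 1 or 2 modulo 3.
      -- Equal differences therefore have the same step, and dividing by ζ - 1 or ζ² - 1 gives m =
      -- m'.
      have h3 := congrArg (· ^ 3) h1
      simp only [cube_zeta_pow_sub, if_neg hmn, if_neg hmn'] at h3
      have hw := hr.neg_eq_self hr.zeta_sub_ne
      have hz : r.ζ - 1 ≠ 0 := sub_ne_zero.2 (r.isPrimitiveRoot_ζ.ne_one (by norm_num))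
      have hz2 : r.ζ ^ 2 - 1 ≠ 0 := by
        rw [sub_ne_zero, ← pow_zero r.ζ, Ne, zeta_pow_inj]; norm_num
      split_ifs at h3 with hd hd' hd'
      · have e1 : r.ζ ^ n = r.ζ ^ m * r.ζ := by rw [← pow_succ, zeta_pow_inj]; omega
        have e2 : r.ζ ^ n' = r.ζ ^ m' * r.ζ := by rw [← pow_succ, zeta_pow_inj]; omega
        rw [e1, e2] at h1
        have : r.ζ ^ m = r.ζ ^ m' := mul_right_cancel₀ hz (by linear_combination -h1)
        rw [zeta_pow_inj] at this
        omega
      · exact absurd h3 hw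
      · exact absurd h3.symm hw
      · have e1 : r.ζ ^ n = r.ζ ^ m * r.ζ ^ 2 := by rw [← pow_add, zeta_pow_inj]; omega
        have e2 : r.ζ ^ n' = r.ζ ^ m' * r.ζ ^ 2 := by rw [← pow_add, zeta_pow_inj]; omega
        rw [e1, e2] at h1
        have : r.ζ ^ m = r.ζ ^ m' := mul_right_cancel₀ hz2 (by linear_combination -h1)
        rw [zeta_pow_inj] at this
        omega
    · rintro ⟨hm, hn⟩
      rw [← sum_mod, hm, hn, sum_mod]
  obtain ⟨h0, h1⟩ := hσ.code_of_β_eq hr (e := 0) (by simpa using h)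
  have hs := sOf_lt hσ.lt
  have ht := tOf_lt g
  rw [eval_sum, hσ.map_sum, Sym.fixes, fixesSum]
  split_ifs with hs0
  · have := h0 hs0
    rw [hinj (by interval_cases tOf g <;> omega) (by omega)]
    simp only [zero_add, Nat.mod_eq_of_lt hu, Nat.mod_eq_of_lt hv, Bool.and_eq_true, beq_iff_eq]
  · have := h1 (by omega)
    rw [hinj (by interval_cases tOf g <;> omega) (by omega), and_comm]
    simp only [zero_add, Nat.mod_eq_of_lt hu, Nat.mod_eq_of_lt hv, Bool.and_eq_true, beq_iff_eq]

/-! ### Admissible choices of radicals -/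

/-- The choice of radicals with `α ζ ^ k` and `β ζ ^ m` in place of `α` and `β`. -/
def twist (r : Radicals F a b) (k m : ℕ) : Radicals F a b where
  __ := r
  α := r.α * r.ζ ^ k
  β := r.β * r.ζ ^ m
  α_cube := by
    rw [mul_pow, ← pow_mul, mul_comm k, pow_mul, r.zeta_pow, one_pow, mul_one, r.α_cube]
  β_cube := by
    rw [mul_pow, ← pow_mul, mul_comm m, pow_mul, r.zeta_pow, one_pow, mul_one, r.β_cube]

theorem exists_cbrtMem (hr : r.Regular) (hb : IsCubeIn b) : ∃ r : Radicals F a b, r.CbrtMem := by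
  obtain ⟨k, hk⟩ := (isCubeIn_iff hr).1 hb
  refine ⟨r.twist k 0, ?_⟩
  rw [eval_cbrt] at hk
  have : (r.twist k 0).cbrt = r.cbrt * r.ζ ^ (k : ℕ) := by
    simp only [twist, cbrt]; ring
  rwa [CbrtMem, this]

theorem exists_rootRMem (hr : r.Regular) (hR : ¬ Irreducible (cubicR a b)) :
    ∃ r : Radicals F a b, r.RootRMem := by
  obtain ⟨k, hk⟩ := (not_irreducible_cubicR_iff hr).1 hR
  -- Twisting by ζ^k and ζ^(2k) leaves αβ unchanged and moves ρ_k to the position of ρ₀.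
  refine ⟨r.twist k (2 * k), ?_⟩
  rw [eval_rho] at hk
  have h3 : r.ζ ^ (k : ℕ) * r.ζ ^ (2 * k : ℕ) = 1 := by
    rw [← pow_add, show (k : ℕ) + 2 * k = 3 * k by ring, pow_mul, r.zeta_pow, one_pow]
  have : (r.twist k (2 * k)).cbrt * ((r.twist k (2 * k)).α + (r.twist k (2 * k)).β) =
      r.cbrt * r.sum k (2 * k) := by
    simp only [twist, cbrt, sum]
    linear_combination r.α * r.β * (r.α * r.ζ ^ (k : ℕ) + r.β * r.ζ ^ (2 * k : ℕ)) * h3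
  rwa [RootRMem, this]

/-- The mask of the full Galois group for a choice of radicals, with the conditions that
distinguish the cases read off from it. -/
theorem exists_mask [FiniteDimensional K F] [IsGalois K F] {r : Radicals F a b} (hr : r.Regular)
    (hf : Irreducible (sextic a b)) :
    ∃ H ∈ subgroupMasks, r.HasMask ⊥ H ∧ transMask H = true ∧
      (allFix H .zeta = true ↔ HasZeta K) ∧
      (allFix H .sqrtNegThreeDelta = true ↔ DeltaIsNegThreeSq a b) ∧
      (cubeMask H = true ↔ IsCubeIn b) ∧
      (rootMask H = true ↔ ¬ Irreducible (cubicR a b)) := by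
  obtain ⟨H, hH, hm⟩ := r.exists_hasMask ⊥
  exact ⟨H, hH, hm, transMask_eq_true hr hf hm,
    (mem_range_of_allFix hm (fixOK_zeta r)).trans (hasZeta_iff r).symm,
    (mem_range_of_allFix hm (fixOK_sqrtNegThreeDelta hr)).trans (deltaIsNegThreeSq_iff hr).symm,
    cubeMask_iff hr hm, rootMask_iff hr hm⟩

theorem isCompleteList_of_ne_zero [FiniteDimensional K F] [IsGalois K F] {r : Radicals F a b}
    (hr : r.Regular) (hF : (sextic a b).IsSplittingField K F) (ha : a ≠ 0) {H : ℕ}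
    (hH : r.HasMask ⊥ H) {T : List SymRow} (hc : completeFor H T = true) :
    IsCompleteList (T.map r.rowOf) :=
  isCompleteList hr hF hH (fun _ _ _ _ s _ => fixOK_of_ne_zero hr ha s) hc

/-- If a = 0, the condition on the radicals gives β = -α and ρ₀ = 0; formal fixing then comes from
the restriction on codes, not from ρ₀ lying in K. -/
theorem allFix_rho_zero [FiniteDimensional K F] [IsGalois K F] {r : Radicals F a b}
    (hr : r.Regular) (hΔ : ¬ DeltaIsNegThreeSq a b) (hroot : r.RootRMem) {H : ℕ}
    (hH : r.HasMask ⊥ H) : allFix H (.rho 0) = true := by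
  by_cases ha : a = 0
  · exact allFix_of_forall hH fun σ g hσ =>
      fixes_rho_of_β_eq hr (e := 0) (by simpa using β_eq_neg hr ha hΔ hroot) rfl hσ
  · exact (mem_range_of_allFix hH (fixOK_rho hr ha 0)).2 hroot

/-- Every sum in this list has unequal exponents, so it does not vanish for β = -α and is still
fixed only formally. -/
theorem fixOK_symD6NotCube {r : Radicals F a b} (hr : r.Regular)
    (hΔ : ¬ DeltaIsNegThreeSq a b) (hroot : r.RootRMem) :
    ∀ R ∈ symD6NotCube, ∀ l ∈ R.normal ++ R.nonNormal, ∀ s ∈ l, r.FixOK s := by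
  have hsum : ∀ u v : Fin 3, u ≠ v → r.FixOK (.sum u v) := fun u v huv => by
    by_cases ha : a = 0
    · exact fixOK_sum_of_β_eq_neg hr (β_eq_neg hr ha hΔ hroot) huv
    · exact fixOK_sum hr ha u v
  simp [symD6NotCube, fixOK_sqrtDelta hr, fixOK_zeta r, fixOK_sqrtNegThreeDelta hr,
    fixOK_cbrt hr, fixOK_alpha hr, hsum]

end Radicals

end SexticTrinomial

/-! ### The nine cases -/

open SexticTrinomial Radicals in
theorem mainTheorem3 {K : Type*} {F : Type*} [Field K] [Field F] [Algebra K F]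
    (h2 : (2 : K) ≠ 0) (h3 : (3 : K) ≠ 0) (a b : K)
    (hf : Irreducible (SexticTrinomial.sextic a b))
    (hF : (SexticTrinomial.sextic a b).IsSplittingField K F) :
    -- the radicals exist in `F`
    Nonempty (SexticTrinomial.Radicals F a b) ∧
    -- the cases below are exhaustive
    (SexticTrinomial.IsCubeIn b → Irreducible (SexticTrinomial.cubicR a b)) ∧
    -- `ζ ∉ K` and `Δ ≠ - 3 n ^ 2`
    (¬ SexticTrinomial.HasZeta K → ¬ SexticTrinomial.DeltaIsNegThreeSq a b →
      (¬ SexticTrinomial.IsCubeIn b → ¬ Irreducible (SexticTrinomial.cubicR a b) →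
        Nonempty (Gal(F/K) ≃* DihedralGroup 6) ∧
        (SexticTrinomial.properSubfields K F).ncard = 14 ∧
        (∃ r : SexticTrinomial.Radicals F a b, r.RootRMem) ∧
        ∀ r : SexticTrinomial.Radicals F a b, r.RootRMem →
          SexticTrinomial.IsCompleteList r.listD6NotCube) ∧
      (SexticTrinomial.IsCubeIn b → Irreducible (SexticTrinomial.cubicR a b) →
        Nonempty (Gal(F/K) ≃* DihedralGroup 6) ∧
        (SexticTrinomial.properSubfields K F).ncard = 14 ∧
        (∃ r : SexticTrinomial.Radicals F a b, r.CbrtMem) ∧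
        ∀ r : SexticTrinomial.Radicals F a b, r.CbrtMem →
          SexticTrinomial.IsCompleteList r.listD6Cube) ∧
      (¬ SexticTrinomial.IsCubeIn b → Irreducible (SexticTrinomial.cubicR a b) →
        Nonempty (Gal(F/K) ≃* Equiv.Perm (Fin 3) × Equiv.Perm (Fin 3)) ∧
        (SexticTrinomial.properSubfields K F).ncard = 58 ∧
        ∀ r : SexticTrinomial.Radicals F a b,
          SexticTrinomial.IsCompleteList r.listS3S3)) ∧
    -- `ζ ∉ K` and `Δ = - 3 n ^ 2`
    (¬ SexticTrinomial.HasZeta K → SexticTrinomial.DeltaIsNegThreeSq a b →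
      (¬ SexticTrinomial.IsCubeIn b → ¬ Irreducible (SexticTrinomial.cubicR a b) →
        Nonempty (Gal(F/K) ≃* Equiv.Perm (Fin 3)) ∧
        (SexticTrinomial.properSubfields K F).ncard = 4 ∧
        ∀ r : SexticTrinomial.Radicals F a b,
          SexticTrinomial.IsCompleteList r.listS3NoZeta) ∧
      (SexticTrinomial.IsCubeIn b → Irreducible (SexticTrinomial.cubicR a b) →
        Nonempty (Gal(F/K) ≃* Multiplicative (ZMod 6)) ∧
        (SexticTrinomial.properSubfields K F).ncard = 2 ∧
        (∃ r : SexticTrinomial.Radicals F a b, r.CbrtMem) ∧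
        ∀ r : SexticTrinomial.Radicals F a b, r.CbrtMem →
          SexticTrinomial.IsCompleteList r.listC6NoZeta) ∧
      (¬ SexticTrinomial.IsCubeIn b → Irreducible (SexticTrinomial.cubicR a b) →
        Nonempty (Gal(F/K) ≃* Multiplicative (ZMod 3) × Equiv.Perm (Fin 3)) ∧
        (SexticTrinomial.properSubfields K F).ncard = 12 ∧
        ∀ r : SexticTrinomial.Radicals F a b,
          SexticTrinomial.IsCompleteList r.listC3S3NoZeta)) ∧
    -- `ζ ∈ K`
    (SexticTrinomial.HasZeta K →
      (¬ SexticTrinomial.IsCubeIn b → ¬ Irreducible (SexticTrinomial.cubicR a b) →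
        Nonempty (Gal(F/K) ≃* Multiplicative (ZMod 6)) ∧
        (SexticTrinomial.properSubfields K F).ncard = 2 ∧
        ∀ r : SexticTrinomial.Radicals F a b,
          SexticTrinomial.IsCompleteList r.listC6Zeta) ∧
      (SexticTrinomial.IsCubeIn b → Irreducible (SexticTrinomial.cubicR a b) →
        Nonempty (Gal(F/K) ≃* Equiv.Perm (Fin 3)) ∧
        (SexticTrinomial.properSubfields K F).ncard = 4 ∧
        ∀ r : SexticTrinomial.Radicals F a b,
          SexticTrinomial.IsCompleteList r.listS3Zeta) ∧
      (¬ SexticTrinomial.IsCubeIn b → Irreducible (SexticTrinomial.cubicR a b) →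
        Nonempty (Gal(F/K) ≃* Multiplicative (ZMod 3) × Equiv.Perm (Fin 3)) ∧
        (SexticTrinomial.properSubfields K F).ncard = 12 ∧
        ∀ r : SexticTrinomial.Radicals F a b,
          SexticTrinomial.IsCompleteList r.listC3S3Zeta)) := by
  have hsep := sextic_separable h2 h3 hf
  have : FiniteDimensional K F := IsSplittingField.finiteDimensional F (sextic a b)
  have : IsGalois K F := IsGalois.of_separable_splitting_field hsep
  have hreg : ∀ r : Radicals F a b, r.Regular := Radicals.regular h2 h3 hf
  obtain ⟨r₀⟩ := nonempty_radicals h2 h3 hf hF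
  have hmask := fun r : Radicals F a b => exists_mask (hreg r) hf
  refine ⟨⟨r₀⟩, ?_, ?_, ?_, ?_⟩
  · intro hb
    obtain ⟨H, hH, hm, htr, -, -, hcube, hroot⟩ := hmask r₀
    have := rootMask_of_cubeMask H hH htr (hcube.2 hb)
    by_contra hR
    rw [hroot.2 hR] at this
    exact Bool.noConfusion this
  · intro hζ hΔ
    refine ⟨fun hb hR => ?_, fun hb hR => ?_, fun hb hR => ?_⟩
    · have hex := exists_rootRMem (hreg r₀) hR
      have key : ∀ r : Radicals F a b, r.RootRMem →
          IsCompleteList r.listD6NotCube ∧ Nonempty (Gal(F/K) ≃* DihedralGroup 6) := by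
        intro r hr
        obtain ⟨H, hH, hm, htr, hz, hd, hcube, -⟩ := hmask r
        rw [← hz, Bool.not_eq_true] at hζ
        have hd' := hΔ
        rw [← hd, Bool.not_eq_true] at hd'
        rw [← hcube, Bool.not_eq_true] at hb
        have h0 := allFix_rho_zero (hreg r) hΔ hr hm
        exact ⟨isCompleteList (hreg r) hF hm (fixOK_symD6NotCube (hreg r) hΔ hr)
          (completeFor_symD6NotCube H hH htr hζ hd' hb h0),
          nonempty_mulEquiv (hreg r) hF hm (isoCode_symD6NotCube H hH htr hζ hd' hb h0)⟩
      obtain ⟨r, hr⟩ := hex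
      exact ⟨(key r hr).2, (key r hr).1.ncard, ⟨r, hr⟩, fun r hr => (key r hr).1⟩
    · have hex := exists_cbrtMem (hreg r₀) hb
      have ha := ne_zero_of_irreducible_cubicR hR
      have key : ∀ r : Radicals F a b, r.CbrtMem →
          IsCompleteList r.listD6Cube ∧ Nonempty (Gal(F/K) ≃* DihedralGroup 6) := by
        intro r hr
        obtain ⟨H, hH, hm, htr, hz, hd, -, -⟩ := hmask r
        rw [← hz, Bool.not_eq_true] at hζ
        rw [← hd, Bool.not_eq_true] at hΔ
        have h0 := (mem_range_of_allFix hm (fixOK_cbrt (hreg r) 0)).2 hr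
        exact ⟨isCompleteList_of_ne_zero (hreg r) hF ha hm
          (completeFor_symD6Cube H hH htr hζ hΔ h0),
          nonempty_mulEquiv (hreg r) hF hm (isoCode_symD6Cube H hH htr hζ hΔ h0)⟩
      obtain ⟨r, hr⟩ := hex
      exact ⟨(key r hr).2, (key r hr).1.ncard, ⟨r, hr⟩, fun r hr => (key r hr).1⟩
    · have ha := ne_zero_of_irreducible_cubicR hR
      have key : ∀ r : Radicals F a b, IsCompleteList r.listS3S3 ∧
          Nonempty (Gal(F/K) ≃* Equiv.Perm (Fin 3) × Equiv.Perm (Fin 3)) := by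
        intro r
        obtain ⟨H, hH, hm, htr, hz, hd, hcube, hroot⟩ := hmask r
        rw [← hz, Bool.not_eq_true] at hζ
        rw [← hd, Bool.not_eq_true] at hΔ
        rw [← hcube, Bool.not_eq_true] at hb
        have hR := (Bool.not_eq_true _).mp (mt hroot.1 (not_not.2 hR))
        exact ⟨isCompleteList_of_ne_zero (hreg r) hF ha hm
          (completeFor_symS3S3 H hH htr hζ hΔ hb hR),
          nonempty_mulEquiv (hreg r) hF hm (isoCode_symS3S3 H hH htr hζ hΔ hb hR)⟩
      exact ⟨(key r₀).2, (key r₀).1.ncard, fun r => (key r).1⟩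
  · intro hζ hΔ
    refine ⟨fun hb hR => ?_, fun hb hR => ?_, fun hb hR => ?_⟩
    · have key : ∀ r : Radicals F a b, IsCompleteList r.listS3NoZeta ∧
          Nonempty (Gal(F/K) ≃* Equiv.Perm (Fin 3)) := by
        intro r
        obtain ⟨H, hH, hm, htr, hz, hd, hcube, hroot⟩ := hmask r
        rw [← hz, Bool.not_eq_true] at hζ
        rw [← hcube, Bool.not_eq_true] at hb
        obtain ⟨w, -, hw⟩ := isoCode_symS3NoZeta H hH htr hζ (hd.2 hΔ) hb (hroot.2 hR)
        refine ⟨isCompleteList (hreg r) hF hm ?_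
          (completeFor_symS3NoZeta H hH htr hζ (hd.2 hΔ) hb (hroot.2 hR)),
          nonempty_mulEquiv (hreg r) hF hm hw⟩
        -- Here R is reducible and a may be 0, but the list contains no sums of α and β, so no
        -- nondegeneracy is required.
        simp [symS3NoZeta, fixOK_sqrtNegThree (hreg r), fixOK_cbrt (hreg r)]
      exact ⟨(key r₀).2, (key r₀).1.ncard, fun r => (key r).1⟩
    · have hex := exists_cbrtMem (hreg r₀) hb
      have ha := ne_zero_of_irreducible_cubicR hR
      have key : ∀ r : Radicals F a b, r.CbrtMem →
          IsCompleteList r.listC6NoZeta ∧ Nonempty (Gal(F/K) ≃* Multiplicative (ZMod 6)) := by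
        intro r hr
        obtain ⟨H, hH, hm, htr, hz, hd, -, -⟩ := hmask r
        rw [← hz, Bool.not_eq_true] at hζ
        have h0 := (mem_range_of_allFix hm (fixOK_cbrt (hreg r) 0)).2 hr
        exact ⟨isCompleteList_of_ne_zero (hreg r) hF ha hm
          (completeFor_symC6NoZeta H hH htr hζ (hd.2 hΔ) h0),
          nonempty_mulEquiv (hreg r) hF hm (isoCode_symC6NoZeta H hH htr hζ (hd.2 hΔ) h0)⟩
      obtain ⟨r, hr⟩ := hex
      exact ⟨(key r hr).2, (key r hr).1.ncard, ⟨r, hr⟩, fun r hr => (key r hr).1⟩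
    · have ha := ne_zero_of_irreducible_cubicR hR
      have key : ∀ r : Radicals F a b, IsCompleteList r.listC3S3NoZeta ∧
          Nonempty (Gal(F/K) ≃* Multiplicative (ZMod 3) × Equiv.Perm (Fin 3)) := by
        intro r
        obtain ⟨H, hH, hm, htr, hz, hd, hcube, hroot⟩ := hmask r
        rw [← hz, Bool.not_eq_true] at hζ
        rw [← hcube, Bool.not_eq_true] at hb
        have hR := (Bool.not_eq_true _).mp (mt hroot.1 (not_not.2 hR))
        exact ⟨isCompleteList_of_ne_zero (hreg r) hF ha hm
          (completeFor_symC3S3NoZeta H hH htr hζ (hd.2 hΔ) hb hR),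
          nonempty_mulEquiv (hreg r) hF hm (isoCode_symC3S3NoZeta H hH htr hζ (hd.2 hΔ) hb hR)⟩
      exact ⟨(key r₀).2, (key r₀).1.ncard, fun r => (key r).1⟩
  · intro hζ
    refine ⟨fun hb hR => ?_, fun hb hR => ?_, fun hb hR => ?_⟩
    · have key : ∀ r : Radicals F a b, IsCompleteList r.listC6Zeta ∧
          Nonempty (Gal(F/K) ≃* Multiplicative (ZMod 6)) := by
        intro r
        obtain ⟨H, hH, hm, htr, hz, -, hcube, hroot⟩ := hmask r
        rw [← hcube, Bool.not_eq_true] at hb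
        obtain ⟨w, -, hw⟩ := isoCode_symC6Zeta H hH htr (hz.2 hζ) hb (hroot.2 hR)
        refine ⟨isCompleteList (hreg r) hF hm ?_
          (completeFor_symC6Zeta H hH htr (hz.2 hζ) hb (hroot.2 hR)),
          nonempty_mulEquiv (hreg r) hF hm hw⟩
        simp [symC6Zeta, fixOK_sqrtDelta (hreg r), fixOK_cbrt (hreg r)]
      exact ⟨(key r₀).2, (key r₀).1.ncard, fun r => (key r).1⟩
    · have ha := ne_zero_of_irreducible_cubicR hR
      have key : ∀ r : Radicals F a b, IsCompleteList r.listS3Zeta ∧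
          Nonempty (Gal(F/K) ≃* Equiv.Perm (Fin 3)) := by
        intro r
        obtain ⟨H, hH, hm, htr, hz, -, hcube, -⟩ := hmask r
        obtain ⟨w, -, hw⟩ := isoCode_symS3Zeta H hH htr (hz.2 hζ) (hcube.2 hb)
        exact ⟨isCompleteList_of_ne_zero (hreg r) hF ha hm
          (completeFor_symS3Zeta H hH htr (hz.2 hζ) (hcube.2 hb)),
          nonempty_mulEquiv (hreg r) hF hm hw⟩
      exact ⟨(key r₀).2, (key r₀).1.ncard, fun r => (key r).1⟩
    · have ha := ne_zero_of_irreducible_cubicR hR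
      have key : ∀ r : Radicals F a b, IsCompleteList r.listC3S3Zeta ∧
          Nonempty (Gal(F/K) ≃* Multiplicative (ZMod 3) × Equiv.Perm (Fin 3)) := by
        intro r
        obtain ⟨H, hH, hm, htr, hz, -, hcube, hroot⟩ := hmask r
        rw [← hcube, Bool.not_eq_true] at hb
        have hR := (Bool.not_eq_true _).mp (mt hroot.1 (not_not.2 hR))
        exact ⟨isCompleteList_of_ne_zero (hreg r) hF ha hm
          (completeFor_symC3S3Zeta H hH htr (hz.2 hζ) hb hR),
          nonempty_mulEquiv (hreg r) hF hm (isoCode_symC3S3Zeta H hH htr (hz.2 hζ) hb hR)⟩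
      exact ⟨(key r₀).2, (key r₀).1.ncard, fun r => (key r).1⟩
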